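/- For positive integers $r,s,n$ and $m\ge 0$, an $r\times s$ partial Latin rectangle on $n$ symbols is an $r\times s$ matrix with entries in $\{1,\dots,n\}\cup\{\cdot\}$ in which every row and every column contains each symbol of $\{1,\dots,n\}$ at most once; its weight is its number of non-empty cells (cells not containing $\cdot$). An ordered partial Latin rectangle of weight $m$ is a sequence of $m$ triples $e_t\in[r]\times[s]\times[n]$ such that, placing the symbol $e_t[3]$ into cell $(e_t[1],e_t[2])$ for each $t$, one obtains a partial Latin rectangle of weight $m$ (every non-empty cell receives exactly one symbol, once). Let $f_m(r,s,n)$ be the number of these sequences; thus $f_m(r,s,n)$ is $m!$ times the number of $r\times s$ partial Latin rectangles on $n$ symbols of weight $m$. Let $\overline{abc}$ denote the sum of the distinct monic monomials in the variables $r,s,n$ whose exponents are $a,b,c$ in some order (e.g. $\overline{100}=r+s+n$ and $\overline{111}=rsn$). Theorem. For every positive integer $m$ there is a polynomial $R_m\in\mathbb Z[r,s,n]$ all of whose monomials have total degree at most $3m-10$ (in particular $R_m=0$ if $m\le 3$), such that for all positive integers $r,s,n$ $$f_m(r,s,n)=(rsn)^m+\sum_{v=2}^{8}\binom{m}{v}(rsn)^{m-v+1}Q_v(r,s,n)+R_m(r,s,n),$$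 where - $Q_2=2-\overline{100}$; - $Q_3=14-12\,\overline{100}+6\,\overline{110}+2\,\overline{200}$; - $Q_4=198-228\,\overline{100}+198\,\overline{110}-84\,\overline{111}+72\,\overline{200}-36\,\overline{210}-12\,\overline{211}+6\,\overline{221}-6\,\overline{300}+3\,\overline{311}$; - $Q_5=4512-6360\,\overline{100}+7440\,\overline{110}-6080\,\overline{111}+2880\,\overline{200}-2520\,\overline{210}+820\,\overline{211}+480\,\overline{220}+360\,\overline{221}-180\,\overline{222}-480\,\overline{300}+240\,\overline{310}+160\,\overline{311}-80\,\overline{321}+24\,\overline{400}-20\,\overline{411}$; - $Q_6=-13170\,\overline{211}+17340\,\overline{221}-15990\,\overline{222}+7580\,\overline{311}-7050\,\overline{321}+3300\,\overline{322}+1520\,\overline{331}+180\,\overline{332}-90\,\overline{333}-1740\,\overline{411}+870\,\overline{421}+90\,\overline{422}-45\,\overline{432}+130\,\overline{511}-15\,\overline{522}$; - $Q_7=-10920\,\overline{322}+15540\,\overline{332}-15120\,\overline{333}+7350\,\overline{422}-7140\,\overline{432}+3570\,\overline{433}+1680\,\overline{442}-2100\,\overline{522}+1050\,\overline{532}+210\,\overline{622}$;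 - $Q_8=-3360\,\overline{433}+5040\,\overline{443}-5040\,\overline{444}+2520\,\overline{533}-2520\,\overline{543}+1260\,\overline{544}+630\,\overline{553}-840\,\overline{633}+420\,\overline{643}+105\,\overline{733}$. (Terms with $v>m$ vanish because $\binom{m}{v}=0$.) Moreover the formula is exact for $m\le 5$, that is, $R_m=0$ for $m\le 5$. -/

import Mathlib

noncomputable section

/-- An `r × s` matrix `L` with entries in `[n] ∪ {·}` (the empty symbol being `none`) is a partial
Latin rectangle if each row and each column has at most one copy of any symbol of `[n]`. -/
def IsPartialLatinRectangle {r s n : ℕ} (L : Matrix (Fin r) (Fin s) (Option (Fin n))) : Prop :=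
  (∀ (i : Fin r) (j j' : Fin s) (k : Fin n), L i j = some k → L i j' = some k → j = j') ∧
  (∀ (j : Fin s) (i i' : Fin r) (k : Fin n), L i j = some k → L i' j = some k → i = i')

/-- The weight of `L`: its number of non-empty cells. -/
def plrWeight {r s n : ℕ} (L : Matrix (Fin r) (Fin s) (Option (Fin n))) : ℕ :=
  (Finset.univ.filter fun c : Fin r × Fin s => L c.1 c.2 ≠ none).card

/-- `PLR(r, s, n; m)`: the `r × s` partial Latin rectangles on `n` symbols of weight `m`. -/
def PLR (r s n m : ℕ) : Set (Matrix (Fin r) (Fin s) (Option (Fin n))) :=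
  {L | IsPartialLatinRectangle L ∧ plrWeight L = m}

/-- The `r × s` matrix of multisets of symbols built from a sequence `e` of `m` triples
`(row, column, symbol)`: cell `(i, j)` receives the symbol of `e t`, for each `t` such that
`e t` has row `i` and column `j`. -/
def multisetMatrix {r s n m : ℕ} (e : Fin m → Fin r × Fin s × Fin n) :
    Matrix (Fin r) (Fin s) (Multiset (Fin n)) := fun i j =>
  (Finset.univ.filter fun t : Fin m => (e t).1 = i ∧ (e t).2.1 = j).val.map fun t => (e t).2.2

/-- The multiset held by a cell of a partial Latin rectangle: the empty cell holds `∅` and a cell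
with symbol `k` holds `{k}`. -/
def cellMultiset {n : ℕ} : Option (Fin n) → Multiset (Fin n)
  | none => 0
  | some k => {k}

/-- `𝒜_m`: the sequences of `m` triples in `[r] × [s] × [n]` whose matrix of multisets is a
partial Latin rectangle of weight `m`, that is, the ordered partial Latin rectangles. -/
def orderedPLR (r s n m : ℕ) : Set (Fin m → Fin r × Fin s × Fin n) :=
  {e | ∃ L ∈ PLR r s n m, ∀ i j, multisetMatrix e i j = cellMultiset (L i j)}

/-- `f_m(r, s, n) = |𝒜_m|`. -/
def plrCount (m r s n : ℕ) : ℕ := (orderedPLR r s n m).ncard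

/-- The polynomial `rsn`, in the variables `r = X 0`, `s = X 1`, `n = X 2`. -/
def rsn : MvPolynomial (Fin 3) ℤ := MvPolynomial.X 0 * MvPolynomial.X 1 * MvPolynomial.X 2

/-- The monomial symmetric polynomial with exponents `a, b, c`: the sum of the distinct monic
monomials in `r`, `s`, `n` whose exponents are `a, b, c` in some order. -/
def mono3 (a b c : ℕ) : MvPolynomial (Fin 3) ℤ :=
  ∑ p ∈ Finset.univ.image (fun σ : Equiv.Perm (Fin 3) => (![a, b, c] : Fin 3 → ℕ) ∘ σ),
    ∏ i, MvPolynomial.X i ^ p i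

/-- The symmetric polynomial that multiplies `m.choose v * rsn ^ (m - v + 1)`, for `2 ≤ v ≤ 8`. -/
def leadingCoeffPoly : ℕ → MvPolynomial (Fin 3) ℤ
  | 2 => 2 - mono3 1 0 0
  | 3 => 14 - 12 * mono3 1 0 0 + 6 * mono3 1 1 0 + 2 * mono3 2 0 0
  | 4 => 198 - 228 * mono3 1 0 0 + 198 * mono3 1 1 0 - 84 * mono3 1 1 1 + 72 * mono3 2 0 0
      - 36 * mono3 2 1 0 - 12 * mono3 2 1 1 + 6 * mono3 2 2 1 - 6 * mono3 3 0 0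
      + 3 * mono3 3 1 1
  | 5 => 4512 - 6360 * mono3 1 0 0 + 7440 * mono3 1 1 0 - 6080 * mono3 1 1 1
      + 2880 * mono3 2 0 0 - 2520 * mono3 2 1 0 + 820 * mono3 2 1 1 + 480 * mono3 2 2 0
      + 360 * mono3 2 2 1 - 180 * mono3 2 2 2 - 480 * mono3 3 0 0 + 240 * mono3 3 1 0
      + 160 * mono3 3 1 1 - 80 * mono3 3 2 1 + 24 * mono3 4 0 0 - 20 * mono3 4 1 1
  | 6 => -13170 * mono3 2 1 1 + 17340 * mono3 2 2 1 - 15990 * mono3 2 2 2 + 7580 * mono3 3 1 1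
      - 7050 * mono3 3 2 1 + 3300 * mono3 3 2 2 + 1520 * mono3 3 3 1 + 180 * mono3 3 3 2
      - 90 * mono3 3 3 3 - 1740 * mono3 4 1 1 + 870 * mono3 4 2 1 + 90 * mono3 4 2 2
      - 45 * mono3 4 3 2 + 130 * mono3 5 1 1 - 15 * mono3 5 2 2
  | 7 => -10920 * mono3 3 2 2 + 15540 * mono3 3 3 2 - 15120 * mono3 3 3 3 + 7350 * mono3 4 2 2
      - 7140 * mono3 4 3 2 + 3570 * mono3 4 3 3 + 1680 * mono3 4 4 2 - 2100 * mono3 5 2 2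
      + 1050 * mono3 5 3 2 + 210 * mono3 6 2 2
  | 8 => -3360 * mono3 4 3 3 + 5040 * mono3 4 4 3 - 5040 * mono3 4 4 4 + 2520 * mono3 5 3 3
      - 2520 * mono3 5 4 3 + 1260 * mono3 5 4 4 + 630 * mono3 5 5 3 - 840 * mono3 6 3 3
      + 420 * mono3 6 4 3 + 105 * mono3 7 3 3
  | _ => 0

/-- `(rsn)^m + ∑_{v = 2}^{8} binom(m, v) (rsn)^{m - v + 1} Q_v`. The binomial coefficient vanishes
whenever the exponent `m - v + 1` would be negative, so truncated subtraction is harmless. -/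
def leadingPoly (m : ℕ) : MvPolynomial (Fin 3) ℤ :=
  rsn ^ m + ∑ v ∈ Finset.Icc 2 8, (m.choose v : MvPolynomial (Fin 3) ℤ) * rsn ^ (m + 1 - v) *
    leadingCoeffPoly v

end

/-! Two triples clash if they agree in at least two coordinates. Ordered partial Latin rectangles
are the clash-free sequences (`mem_orderedPLR_iff`), so f_m counts independent families in the clash
graph. Taking the first triple as a root, a cluster expansion gives f_{m+1} = ∑_k binom(m,k) c_k
f_{m-k} (`indepSum_succ`), where c_k sums over k+1 triples a weight that vanishes unless their clash
graph is connected. In a connected clash graph, built up triple by triple, each new triple brings at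
most one new row, column or symbol; hence c_k is a polynomial of degree at most k+3, and c_0 = rsn.

For exponential generating functions the recursion reads F' = cF. Splitting off c_0 gives f_m = ∑_v
binom(m,v) (rsn)^{m-v} g_v (`eq_sum_coreSeq`), where g_v sums over the partitions of v points into
blocks of size at least 2, a block of size k+1 weighing c_k. So deg g_v ≤ v + 2⌊v/2⌋, which is at
most 3v-10 once v ≥ 9, and only v ≤ 8 can affect the leading part.

For 1 ≤ m ≤ 5 the polynomial f_m is computed outright by enumerating triples of set partitions. This
yields g_v = rsn·Q_v for 1 ≤ v ≤ 5, and from it c_1, c_2, c_3. For v = 6, 7, 8 the products of c's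
whose degree bound exceeds 3v-10 involve only c_1, c_2, c_3; their sum is rsn·Q_v plus a constant
times (rsn)^{v-4}, which is also of low degree. -/

open Finset

namespace PLRCount

noncomputable section

/-! ### Inverting a convolution over subsets -/

section Cluster

variable {ι ι' : Type*} [DecidableEq ι] [DecidableEq ι']

/-- The solution `C` of the convolution equation `∑ T ⊆ S, C T * W (S \ T) = U S`
(when `W ∅ = 1`). -/
def cluster (U W : Finset ι → ℤ) (S : Finset ι) : ℤ :=
  U S - ∑ T ∈ S.ssubsets.attach, cluster U W T.1 * W (S \ T.1)
termination_by S.card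
decreasing_by exact card_lt_card (mem_ssubsets.1 T.2)

theorem cluster_eq_sub (U W : Finset ι → ℤ) (S : Finset ι) :
    cluster U W S = U S - ∑ T ∈ S.ssubsets, cluster U W T * W (S \ T) := by
  rw [cluster, sum_attach S.ssubsets fun T => cluster U W T * W (S \ T)]

theorem sum_cluster_mul (U W : Finset ι → ℤ) (hW : W ∅ = 1) (S : Finset ι) :
    ∑ T ∈ S.powerset, cluster U W T * W (S \ T) = U S := by
  rw [← sum_erase_add _ _ (mem_powerset_self S), Finset.sdiff_self, hW, mul_one, cluster_eq_sub U W S]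
  simp [ssubsets]

theorem cluster_map (U W : Finset ι' → ℤ) (g : ι ↪ ι') (S : Finset ι) :
    cluster U W (S.map g) = cluster (fun T => U (T.map g)) (fun T => W (T.map g)) S := by
  induction S using Finset.strongInduction with
  | H S ih =>
    rw [cluster_eq_sub, cluster_eq_sub]
    congr 1
    symm
    refine sum_bij (fun T _ => T.map g) ?_ ?_ ?_ ?_
    · intro T hT
      rw [mem_ssubsets] at hT ⊢
      exact map_ssubset_map.2 hT
    · intro T _ T' _ h
      exact map_injective g h
    · intro T hT
      rw [mem_ssubsets] at hT
      obtain ⟨T', -, rfl⟩ := subset_map_iff.1 hT.subset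
      exact ⟨T', mem_ssubsets.2 (map_ssubset_map.1 hT), rfl⟩
    · intro T hT
      rw [ih T (mem_ssubsets.1 hT), ← Finset.map_sdiff]

/-- By the convolution equation at `S ∩ A`, the subsets of `S ∩ A` already contribute `U (S ∩ A) * W
(S \ A) = U S`. The other proper subsets contribute nothing by induction, so nothing is left for `S`
itself. -/
theorem cluster_eq_zero_of_split (U W : Finset ι → ℤ) (hW : W ∅ = 1) (A : Finset ι)
    (hUA : ∀ T, U T = U (T ∩ A) * W (T \ A)) (hWA : ∀ T, W T = W (T ∩ A) * W (T \ A))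
    (S : Finset ι) (hS : ¬ S ⊆ A) : cluster U W S = 0 := by
  induction S using Finset.strongInduction with
  | H S ih =>
    rw [cluster_eq_sub, hUA S, ← sum_cluster_mul U W hW (S ∩ A), sum_mul, sub_eq_zero]
    refine sum_subset_zero_on_sdiff ?_ ?_ ?_
    · intro T hT
      rw [mem_powerset] at hT
      refine mem_ssubsets.2 ⟨hT.trans inter_subset_left, fun h => hS ?_⟩
      exact h.trans (hT.trans inter_subset_right)
    · intro T hT
      rw [mem_sdiff, mem_ssubsets, mem_powerset, subset_inter_iff, not_and] at hT
      rw [ih T hT.1 (hT.2 hT.1.subset), zero_mul]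
    · intro T hT
      rw [mem_powerset, subset_inter_iff] at hT
      rw [hWA (S \ T), mul_assoc]
      congr 3
      · ext i
        simp only [mem_inter, mem_sdiff]
        tauto
      · have := hT.2
        ext i
        have := @this i
        simp only [mem_sdiff]
        tauto

end Cluster

/-! ### Independent sets and rooted clusters -/

section Indep

variable {ι ι' : Type*}

open Classical in
/-- The indicator of `S` being independent for the relation `κ`. -/
def indep (κ : ι → ι → Prop) (S : Finset ι) : ℤ :=
  if ∀ i ∈ S, ∀ j ∈ S, i ≠ j → ¬ κ i j then 1 else 0

open Classical in
/-- The indicator of `S` being independent and disjoint from `p`. -/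
def rootedIndep (p : ι → Prop) (κ : ι → ι → Prop) (S : Finset ι) : ℤ :=
  if ∀ i ∈ S, ¬ p i then indep κ S else 0

open Classical in
/-- The cluster function of a relation `κ` together with a root whose neighbours are given
by `p`. -/
def rootedCluster (p : ι → Prop) (κ : ι → ι → Prop) (S : Finset ι) : ℤ :=
  cluster (rootedIndep p κ) (indep κ) S

theorem indep_empty (κ : ι → ι → Prop) : indep κ ∅ = 1 := by simp [indep]

theorem indep_map (κ : ι' → ι' → Prop) (g : ι ↪ ι') (S : Finset ι) :
    indep κ (S.map g) = indep (fun i j => κ (g i) (g j)) S := by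
  simp only [indep]
  congr 1
  simp

theorem rootedIndep_map (p : ι' → Prop) (κ : ι' → ι' → Prop) (g : ι ↪ ι') (S : Finset ι) :
    rootedIndep p κ (S.map g) = rootedIndep (fun i => p (g i)) (fun i j => κ (g i) (g j)) S := by
  simp only [rootedIndep, indep_map]
  congr 1
  simp

theorem rootedCluster_map (p : ι' → Prop) (κ : ι' → ι' → Prop) (g : ι ↪ ι') (S : Finset ι) :
    rootedCluster p κ (S.map g) =
      rootedCluster (fun i => p (g i)) (fun i j => κ (g i) (g j)) S := by
  classical
  simp only [rootedCluster, cluster_map, indep_map, rootedIndep_map]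

open Classical in
theorem indep_split (κ : ι → ι → Prop) (A : Finset ι)
    (hA : ∀ i ∈ A, ∀ j ∉ A, ¬ κ i j ∧ ¬ κ j i) (T : Finset ι) :
    indep κ T = indep κ (T ∩ A) * indep κ (T \ A) := by
  simp only [indep, ite_mul, one_mul, zero_mul, ← ite_and]
  refine if_congr ?_ rfl rfl
  simp only [mem_inter, mem_sdiff]
  refine ⟨fun h => ⟨fun i hi j hj => h i hi.1 j hj.1, fun i hi j hj => h i hi.1 j hj.1⟩, ?_⟩
  rintro ⟨h1, h2⟩ i hi j hj hij
  by_cases hiA : i ∈ A <;> by_cases hjA : j ∈ A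
  · exact h1 i ⟨hi, hiA⟩ j ⟨hj, hjA⟩ hij
  · exact (hA i hiA j hjA).1
  · exact (hA j hjA i hiA).2
  · exact h2 i ⟨hi, hiA⟩ j ⟨hj, hjA⟩ hij

-- With no edge leaving `A` and no neighbour of the root outside it, both indicators factor along
-- `A`. Thus a nonzero cluster is connected to its root.
open Classical in
theorem rootedCluster_eq_zero (p : ι → Prop) (κ : ι → ι → Prop) (A : Finset ι)
    (hp : ∀ j ∉ A, ¬ p j) (hA : ∀ i ∈ A, ∀ j ∉ A, ¬ κ i j ∧ ¬ κ j i) (S : Finset ι)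
    (hS : ¬ S ⊆ A) : rootedCluster p κ S = 0 := by
  refine cluster_eq_zero_of_split _ _ (indep_empty κ) A (fun T => ?_) (indep_split κ A hA) S hS
  simp only [rootedIndep]
  rw [indep_split κ A hA T, ite_mul, zero_mul]
  refine if_congr ?_ rfl rfl
  simp only [mem_inter]
  refine ⟨fun h i hi => h i hi.1, fun h i hi => ?_⟩
  by_cases hiA : i ∈ A
  · exact h i ⟨hi, hiA⟩
  · exact hp i hiA

theorem sum_rootedCluster_mul [Fintype ι] [DecidableEq ι] (p : ι → Prop) (κ : ι → ι → Prop) :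
    ∑ T : Finset ι, rootedCluster p κ T * indep κ Tᶜ = rootedIndep p κ univ := by
  have h := @sum_cluster_mul ι (Classical.decEq ι) (rootedIndep p κ) (indep κ)
    (indep_empty κ) univ
  rw [powerset_univ] at h
  rw [← h]
  refine sum_congr rfl fun T _ => ?_
  rw [rootedCluster, compl_eq_univ_sdiff]
  congr!

theorem indep_univ_succ {k : ℕ} (κ : Fin (k + 1) → Fin (k + 1) → Prop)
    (hκ : ∀ i j, κ i j → κ j i) :
    indep κ univ =
      rootedIndep (fun i : Fin k => κ 0 i.succ) (fun i j => κ i.succ j.succ) univ := by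
  classical
  simp only [rootedIndep, indep, ← ite_and]
  congr 1
  rw [eq_iff_iff]
  simp only [mem_univ, true_imp_iff, Fin.forall_fin_succ, ne_eq, not_true_eq_false, false_imp_iff,
    true_and, Fin.succ_inj, Fin.succ_ne_zero, not_false_eq_true, (Fin.succ_ne_zero _).symm]
  constructor
  · rintro ⟨h1, h2⟩
    exact ⟨h1, fun i => (h2 i).2⟩
  · rintro ⟨h1, h2⟩
    exact ⟨h1, fun i => ⟨fun h => h1 i (hκ _ _ h), h2 i⟩⟩

end Indep

/-! ### The recursion for independent families -/

section Sums

variable {X : Type*} [Fintype X] (K : X → X → Prop)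

/-- The number of `K`-independent families of elements of `X` indexed by `ι`. -/
def indepSum (ι : Type*) [Fintype ι] [DecidableEq ι] : ℤ :=
  ∑ e : ι → X, indep (fun i j => K (e i) (e j)) univ

/-- The sum of the cluster function with root `x` over all families indexed by `ι`. -/
def clusterSum (ι : Type*) [Fintype ι] [DecidableEq ι] (x : X) : ℤ :=
  ∑ e : ι → X, rootedCluster (fun i => K x (e i)) (fun i j => K (e i) (e j)) univ

theorem indepSum_congr {ι ι' : Type*} [Fintype ι] [Fintype ι'] [DecidableEq ι] [DecidableEq ι']
    (g : ι ≃ ι') : indepSum K ι = indepSum K ι' := by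
  refine Fintype.sum_equiv (g.arrowCongr (Equiv.refl X)) _ _ fun e => ?_
  rw [← map_univ_equiv g, indep_map]
  simp

theorem clusterSum_congr {ι ι' : Type*} [Fintype ι] [Fintype ι'] [DecidableEq ι] [DecidableEq ι']
    (g : ι ≃ ι') (x : X) : clusterSum K ι x = clusterSum K ι' x := by
  refine Fintype.sum_equiv (g.arrowCongr (Equiv.refl X)) _ _ fun e => ?_
  rw [← map_univ_equiv g, rootedCluster_map]
  simp

theorem sum_rootedCluster_mul_indep {ι : Type*} [Fintype ι] [DecidableEq ι] (x : X)
    (T : Finset ι) :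
    ∑ e : ι → X, rootedCluster (fun i => K x (e i)) (fun i j => K (e i) (e j)) T *
        indep (fun i j => K (e i) (e j)) Tᶜ =
      clusterSum K (Fin T.card) x * indepSum K (Fin (Fintype.card ι - T.card)) := by
  rw [← clusterSum_congr K T.equivFin x,
    ← indepSum_congr K (Fintype.equivFinOfCardEq
      (show Fintype.card {i // i ∉ T} = Fintype.card ι - T.card by
        rw [Fintype.card_subtype_compl, Fintype.card_coe])),
    clusterSum, indepSum, sum_mul_sum, ← Fintype.sum_prod_type']
  refine Fintype.sum_equiv (Equiv.piEquivPiSubtypeProd (· ∈ T) fun _ => X) _ _ fun e => ?_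
  have h1 : T = (univ : Finset {i // i ∈ T}).map (Function.Embedding.subtype _) := by
    ext i; simp
  have h2 : Tᶜ = (univ : Finset {i // i ∉ T}).map (Function.Embedding.subtype _) := by
    ext i; simp
  rw [h2, indep_map]
  have h3 := rootedCluster_map (fun i => K x (e i)) (fun i j => K (e i) (e j))
    (Function.Embedding.subtype (· ∈ T)) univ
  rw [← h1] at h3
  rw [h3]
  rfl

/-- The first member is the root `x`. Its indicator expands over subsets `T` into a cluster on `T`
times independence of the complement; the sum over families factors, and depends on `T` only through
its size. -/
theorem indepSum_succ (hK : ∀ x y, K x y → K y x) (m : ℕ) :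
    indepSum K (Fin (m + 1)) = ∑ k ∈ range (m + 1),
      (m.choose k : ℤ) * ((∑ x, clusterSum K (Fin k) x) * indepSum K (Fin (m - k))) := by
  have h1 : indepSum K (Fin (m + 1)) = ∑ x : X, ∑ e : Fin m → X,
      rootedIndep (fun i => K x (e i)) (fun i j => K (e i) (e j)) univ := by
    rw [indepSum, ← Fintype.sum_prod_type']
    symm
    refine Fintype.sum_equiv (Fin.consEquiv fun _ => X) _ _ fun e => ?_
    rw [indep_univ_succ _ fun i j => hK _ _]
    simp [Fin.consEquiv]
  rw [h1]
  simp_rw [← sum_rootedCluster_mul]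
  have h2 : ∀ x : X, ∑ e : Fin m → X, ∑ T : Finset (Fin m),
      rootedCluster (fun i => K x (e i)) (fun i j => K (e i) (e j)) T *
        indep (fun i j => K (e i) (e j)) Tᶜ =
      ∑ T : Finset (Fin m), clusterSum K (Fin T.card) x * indepSum K (Fin (m - T.card)) := by
    intro x
    rw [sum_comm]
    refine sum_congr rfl fun T _ => ?_
    rw [sum_rootedCluster_mul_indep, Fintype.card_fin]
  simp_rw [h2]
  rw [sum_comm]
  simp_rw [← sum_mul]
  rw [← powerset_univ, sum_powerset_apply_card
    (fun k => (∑ x, clusterSum K (Fin k) x) * indepSum K (Fin (m - k)))]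
  simp only [nsmul_eq_mul, card_univ, Fintype.card_fin]

end Sums

end

noncomputable section

/-! ### Sums over words as sums over set partitions -/

section Words

/-- The restricted growth words of length `k` (built from right to left), each with its number of
distinct letters: one word for every partition of `Fin k`. -/
def growthWords : (k : ℕ) → List ((Fin k → ℕ) × ℕ)
  | 0 => [(Fin.elim0, 0)]
  | k + 1 => (growthWords k).flatMap fun p =>
      (List.range (p.2 + 1)).map fun x => (Fin.cons x p.1, max p.2 (x + 1))

/-- `H` depends only on which letters of a word are equal. -/
def KernelInvariant {k : ℕ} (H : (Fin k → ℕ) → ℤ) : Prop :=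
  ∀ a a' : Fin k → ℕ, (∀ i j, a i = a j ↔ a' i = a' j) → H a = H a'

theorem image_of_mem_growthWords {k : ℕ} {p : (Fin k → ℕ) × ℕ} (hp : p ∈ growthWords k) :
    univ.image p.1 = range p.2 := by
  induction k with
  | zero =>
    simp only [growthWords, List.mem_singleton] at hp
    subst hp
    rfl
  | succ k ih =>
    simp only [growthWords, List.mem_flatMap, List.mem_map, List.mem_range] at hp
    obtain ⟨q, hq, x, hx, rfl⟩ := hp
    have := ih hq
    ext y
    simp only [Finset.ext_iff, mem_image, mem_univ, true_and, mem_range] at this ⊢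
    rw [Fin.exists_fin_succ]
    simp only [Fin.cons_zero, Fin.cons_succ, this]
    omega

/-- The falling factorial `x (x - 1) ⋯ (x - b + 1)`. -/
def falling {R : Type*} [CommRing R] (x : R) (b : ℕ) : R := ∏ t ∈ range b, (x - t)

/-- A letter that does not occur in `a`. -/
def freshLetter {k : ℕ} (a : Fin k → ℕ) : ℕ := univ.sup a + 1

theorem ne_freshLetter {k : ℕ} (a : Fin k → ℕ) (i : Fin k) : a i ≠ freshLetter a :=
  (Nat.lt_succ_of_le (le_sup (f := a) (mem_univ i))).ne

/-- The sum of `H` over all ways to put a letter from an alphabet of size `r` before `a`. -/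
def consSum {k : ℕ} (r : ℤ) (H : (Fin (k + 1) → ℕ) → ℤ) (a : Fin k → ℕ) : ℤ :=
  ∑ x ∈ univ.image a, H (Fin.cons x a) +
    (r - (univ.image a).card) * H (Fin.cons (freshLetter a) a)

theorem KernelInvariant.cons_eq {k : ℕ} {H : (Fin (k + 1) → ℕ) → ℤ} (hH : KernelInvariant H)
    {a a' : Fin k → ℕ} (h : ∀ i j, a i = a j ↔ a' i = a' j) {x x' : ℕ}
    (hx : ∀ i, a i = x ↔ a' i = x') : H (Fin.cons x a) = H (Fin.cons x' a') := by
  refine hH _ _ fun i j => ?_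
  induction i using Fin.cases <;> induction j using Fin.cases <;>
    simp [h, hx, eq_comm (a := x), eq_comm (a := x')]

theorem KernelInvariant.consSum {k : ℕ} {H : (Fin (k + 1) → ℕ) → ℤ} (hH : KernelInvariant H)
    (r : ℤ) : KernelInvariant (consSum r H) := by
  intro a a' h
  -- `u` relabels the letters of `a` as those of `a'`; its values on other letters are irrelevant.
  obtain ⟨u, hu⟩ : ∃ u : ℕ → ℕ, ∀ i, u (a i) = a' i :=
    ⟨Function.extend a a' id, fun i =>
      Function.FactorsThrough.extend_apply (fun i j hij => (h i j).1 hij) _ _⟩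
  have himg : univ.image a' = (univ.image a).image u := by
    rw [image_image]
    exact image_congr fun i _ => (hu i).symm
  have hinj : Set.InjOn u (univ.image a : Finset ℕ) := by
    intro x hx y hy hxy
    simp only [coe_image, coe_univ, Set.image_univ, Set.mem_range] at hx hy
    obtain ⟨i, rfl⟩ := hx
    obtain ⟨j, rfl⟩ := hy
    rw [hu, hu] at hxy
    exact (h i j).2 hxy
  rw [PLRCount.consSum, PLRCount.consSum, himg, sum_image hinj, card_image_of_injOn hinj]
  congr 1
  · refine sum_congr rfl fun x hx => ?_
    obtain ⟨i, -, rfl⟩ := mem_image.1 hx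
    exact hH.cons_eq h fun j => by rw [hu, h]
  · congr 1
    exact hH.cons_eq h fun i => iff_of_false (ne_freshLetter a i) (ne_freshLetter a' i)

/-- All letters absent from `a` give the same value of `H`, and there are `r` minus the number of
distinct letters of `a` of them. -/
theorem sum_cons_eq_consSum {k r : ℕ} {H : (Fin (k + 1) → ℕ) → ℤ} (hH : KernelInvariant H)
    (a : Fin k → Fin r) :
    ∑ x : Fin r, H (Fin.cons (x : ℕ) fun i => (a i : ℕ)) =
      consSum r H fun i => (a i : ℕ) := by
  have hsub : univ.image (fun i => (a i : ℕ)) ⊆ range r := by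
    intro x hx
    obtain ⟨i, -, rfl⟩ := mem_image.1 hx
    simp
  rw [Fin.sum_univ_eq_sum_range (fun x => H (Fin.cons x fun i => (a i : ℕ))), ← sum_sdiff hsub,
    add_comm, consSum]
  congr 1
  rw [sum_congr rfl (g := fun _ => H (Fin.cons (freshLetter fun i => (a i : ℕ)) _)), sum_const,
    card_sdiff_of_subset hsub, card_range, nsmul_eq_mul, Nat.cast_sub]
  · simpa using card_le_card hsub
  · intro x hx
    refine hH.cons_eq (fun _ _ => Iff.rfl) fun i => iff_of_false ?_
      (ne_freshLetter (fun i => (a i : ℕ)) i)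
    rintro rfl
    simp at hx

/-- A word amounts to a set partition of its positions with distinct letters assigned to the blocks,
and `b` blocks can be labelled in `falling r b` ways. The induction prepends a letter: an old one
keeps the factor, a new one multiplies it by `r - b`. -/
theorem sum_words_eq {k : ℕ} (r : ℕ) {H : (Fin k → ℕ) → ℤ} (hH : KernelInvariant H) :
    ∑ a : Fin k → Fin r, H (fun i => (a i : ℕ)) =
      ((growthWords k).map fun p => H p.1 * falling (r : ℤ) p.2).sum := by
  induction k with
  | zero =>
    simp only [growthWords, univ_unique, sum_singleton, List.map_cons, List.map_nil, List.sum_cons,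
      List.sum_nil, falling, range_zero, prod_empty, mul_one, add_zero]
    exact hH _ _ fun i => i.elim0
  | succ k ih =>
    have h1 : ∑ a : Fin (k + 1) → Fin r, H (fun i => (a i : ℕ)) =
        ∑ a : Fin k → Fin r, ∑ x : Fin r, H (Fin.cons (x : ℕ) fun i => (a i : ℕ)) := by
      rw [sum_comm, ← Fintype.sum_prod_type']
      symm
      refine Fintype.sum_equiv (Fin.consEquiv fun _ => Fin r) _ _ fun e => ?_
      congr 1
      funext i
      induction i using Fin.cases <;> simp [Fin.consEquiv]
    simp_rw [h1, sum_cons_eq_consSum hH]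
    rw [ih (hH.consSum r), growthWords, List.map_flatMap, List.flatMap_def, List.sum_flatten,
      List.map_map]
    congr 1
    refine List.map_congr_left fun p hp => ?_
    have himg := image_of_mem_growthWords hp
    rw [consSum, himg, card_range, Function.comp_apply, List.map_map, List.range_succ, List.map_append, List.sum_append]
    have h2 : ∀ f : ℕ → ℤ, ((List.range p.2).map f).sum = ∑ x ∈ range p.2, f x := fun _ => rfl
    rw [h2, add_mul, sum_mul]
    congr 1
    · refine sum_congr rfl fun x hx => ?_
      rw [mem_range] at hx
      simp [max_eq_left (Nat.succ_le_of_lt hx)]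
    -- The letters of `p.1` are exactly those below `p.2`, so `p.2` is also fresh.
    · have h3 : H (Fin.cons (freshLetter p.1) p.1) = H (Fin.cons p.2 p.1) := by
        refine hH.cons_eq (fun _ _ => Iff.rfl) fun i => iff_of_false (ne_freshLetter _ i) ?_
        have : p.1 i ∈ univ.image p.1 := mem_image_of_mem _ (mem_univ i)
        rw [himg, mem_range] at this
        exact this.ne
      simp [h3, falling, prod_range_succ]
      ring

end Words

end

noncomputable section

/-! ### Clash graphs and the number of letters in a cluster -/

section Clash

/-- Two triples clash if they agree in at least two coordinates. -/
def Clash {α β γ : Type*} (x y : α × β × γ) : Prop :=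
  (x.1 = y.1 ∧ x.2.1 = y.2.1) ∨ (x.1 = y.1 ∧ x.2.2 = y.2.2) ∨ (x.2.1 = y.2.1 ∧ x.2.2 = y.2.2)

theorem Clash.symm {α β γ : Type*} {x y : α × β × γ} (h : Clash x y) : Clash y x := by
  simpa only [Clash, eq_comm] using h

/-- The clash relation on positions of three words. -/
def clashRel {k : ℕ} (a b c : Fin k → ℕ) (i j : Fin k) : Prop :=
  Clash (a i, b i, c i) (a j, b j, c j)

theorem clashRel_val {k r s n : ℕ} (e : Fin k → Fin r × Fin s × Fin n) :
    clashRel (fun i => ((e i).1 : ℕ)) (fun i => ((e i).2.1 : ℕ)) (fun i => ((e i).2.2 : ℕ)) =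
      fun i j => Clash (e i) (e j) := by
  funext i j
  simp [clashRel, Clash, Fin.ext_iff]

theorem clashRel_congr {k : ℕ} {a b c a' b' c' : Fin k → ℕ} (ha : ∀ i j, a i = a j ↔ a' i = a' j)
    (hb : ∀ i j, b i = b j ↔ b' i = b' j) (hc : ∀ i j, c i = c j ↔ c' i = c' j) :
    clashRel a b c = clashRel a' b' c' := by
  funext i j
  simp only [clashRel, Clash, ha i j, hb i j, hc i j]

/-- The cluster function of a relation on `Fin (k + 1)` with root `0`. -/
def zeroCluster {k : ℕ} (κ : Fin (k + 1) → Fin (k + 1) → Prop) : ℤ :=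
  rootedCluster (fun i : Fin k => κ 0 i.succ) (fun i j => κ i.succ j.succ) univ

/-- If no clash left `S`, its nonroot elements would separate the cluster from the rest, and the
cluster function would vanish. -/
theorem exists_clash_of_zeroCluster_ne_zero {k : ℕ} {κ : Fin (k + 1) → Fin (k + 1) → Prop}
    (hκ : ∀ i j, κ i j → κ j i) (h : zeroCluster κ ≠ 0) {S : Finset (Fin (k + 1))}
    (h0 : 0 ∈ S) (hS : S ≠ univ) : ∃ i ∈ S, ∃ j ∉ S, κ i j := by
  by_contra! hcon
  refine h (rootedCluster_eq_zero _ _ (univ.filter fun i : Fin k => i.succ ∈ S) ?_ ?_ univ ?_)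
  · intro j hj
    exact hcon 0 h0 _ (by simpa using hj)
  · intro i hi j hj
    have := hcon i.succ (by simpa using hi) j.succ (by simpa using hj)
    exact ⟨this, fun h => this (hκ _ _ h)⟩
  · intro hsub
    refine hS (eq_univ_iff_forall.2 fun i => ?_)
    induction i using Fin.cases with
    | zero => exact h0
    | succ i => simpa using hsub (mem_univ i)

/-- The root has three coordinates. By connectedness the positions can be added one at a time, each
clashing with an earlier one; it repeats two coordinates and adds at most one new letter. -/
theorem card_images_le_of_zeroCluster_ne_zero {k : ℕ} {a b c : Fin (k + 1) → ℕ}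
    (h : zeroCluster (clashRel a b c) ≠ 0) :
    (univ.image a).card + (univ.image b).card + (univ.image c).card ≤ k + 3 := by
  have key : ∀ m ≤ k, ∃ S : Finset (Fin (k + 1)), 0 ∈ S ∧ S.card = m + 1 ∧
      (S.image a).card + (S.image b).card + (S.image c).card ≤ m + 3 := by
    intro m hm
    induction m with
    | zero => exact ⟨{0}, by simp⟩
    | succ m ih =>
      obtain ⟨S, h0, hcard, hS⟩ := ih (by omega)
      obtain ⟨i, hi, j, hj, hij⟩ := exists_clash_of_zeroCluster_ne_zero
        (fun _ _ => Clash.symm) h h0 (by rintro rfl; simp at hcard; omega)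
      refine ⟨insert j S, mem_insert_of_mem h0, by rw [card_insert_of_notMem hj, hcard], ?_⟩
      simp only [image_insert]
      have hle : ∀ f : Fin (k + 1) → ℕ, (insert (f j) (S.image f)).card ≤ (S.image f).card + 1 :=
        fun f => card_insert_le _ _
      have heq : ∀ f : Fin (k + 1) → ℕ, f i = f j →
          (insert (f j) (S.image f)).card = (S.image f).card := fun f hf => by
        rw [insert_eq_of_mem (hf ▸ mem_image_of_mem f hi)]
      have := hle a
      have := hle b
      have := hle c
      rcases hij with ⟨h1, h2⟩ | ⟨h1, h2⟩ | ⟨h1, h2⟩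
      · have := heq a h1
        have := heq b h2
        omega
      · have := heq a h1
        have := heq c h2
        omega
      · have := heq b h1
        have := heq c h2
        omega
  obtain ⟨S, -, hcard, hS⟩ := key k le_rfl
  have : S = univ := by rw [← card_eq_iff_eq_univ, hcard, Fintype.card_fin]
  rwa [this] at hS

end Clash

/-! ### Polynomiality in r, s, n and degrees of cluster sums -/

section WordPoly

open MvPolynomial

/-- The polynomial whose value at `(r, s, n)` is the sum of `H` over all triples of words of length
`k` in alphabets of sizes `r`, `s` and `n`. -/
def wordPoly {k : ℕ} (H : (Fin k → ℕ) → (Fin k → ℕ) → (Fin k → ℕ) → ℤ) :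
    MvPolynomial (Fin 3) ℤ :=
  ((growthWords k).map fun p => ((growthWords k).map fun q => ((growthWords k).map fun t =>
    (H p.1 q.1 t.1 : MvPolynomial (Fin 3) ℤ) *
      (falling (X 0) p.2 * falling (X 1) q.2 * falling (X 2) t.2)).sum).sum).sum

theorem map_falling {R S : Type*} [CommRing R] [CommRing S] (φ : R →+* S) (x : R) (b : ℕ) :
    φ (falling x b) = falling (φ x) b := by
  simp [falling, map_prod]

/-- The three words are summed one at a time, the last first. Each partial sum is again kernel
invariant in the words that remain (`i2`, `i1`). -/
theorem eval_wordPoly {k : ℕ} (H : (Fin k → ℕ) → (Fin k → ℕ) → (Fin k → ℕ) → ℤ)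
    (h1 : ∀ b c, KernelInvariant fun a => H a b c) (h2 : ∀ a c, KernelInvariant fun b => H a b c)
    (h3 : ∀ a b, KernelInvariant fun c => H a b c) (r s n : ℕ) :
    eval ![(r : ℤ), (s : ℤ), (n : ℤ)] (wordPoly H) =
      ∑ e : Fin k → Fin r × Fin s × Fin n,
        H (fun i => (e i).1) (fun i => (e i).2.1) (fun i => (e i).2.2) := by
  have hsum : ∑ e : Fin k → Fin r × Fin s × Fin n,
        H (fun i => (e i).1) (fun i => (e i).2.1) (fun i => (e i).2.2) =
      ∑ a : Fin k → Fin r, ∑ b : Fin k → Fin s, ∑ c : Fin k → Fin n,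
        H (fun i => a i) (fun i => b i) (fun i => c i) := by
    simp_rw [← Fintype.sum_prod_type']
    refine Fintype.sum_equiv ((Equiv.arrowProdEquivProdArrow _ _ _).trans
      ((Equiv.refl _).prodCongr (Equiv.arrowProdEquivProdArrow _ _ _))) _ _ fun e => rfl
  rw [hsum]
  have e3 : ∀ a b, ∑ c : Fin k → Fin n, H a b (fun i => c i) = _ :=
    fun a b => sum_words_eq n (h3 a b)
  simp_rw [e3]
  have i2 : ∀ a, KernelInvariant fun b =>
      ((growthWords k).map fun p => H a b p.1 * falling (n : ℤ) p.2).sum := by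
    intro a b b' hb
    simp only
    congr 1
    exact List.map_congr_left fun p _ => by
      rw [show H a b p.1 = H a b' p.1 from h2 a p.1 b b' hb]
  have e2 : ∀ a, ∑ b : Fin k → Fin s,
      ((growthWords k).map fun p => H a (fun i => b i) p.1 * falling (n : ℤ) p.2).sum = _ :=
    fun a => sum_words_eq s (i2 a)
  simp_rw [e2]
  have i1 : KernelInvariant fun a => ((growthWords k).map fun q =>
      ((growthWords k).map fun p => H a q.1 p.1 * falling (n : ℤ) p.2).sum *
        falling (s : ℤ) q.2).sum := by
    intro a a' ha
    simp only
    congr 1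
    refine List.map_congr_left fun q _ => ?_
    congr 2
    exact List.map_congr_left fun p _ => by
      rw [show H a q.1 p.1 = H a' q.1 p.1 from h1 q.1 p.1 a a' ha]
  rw [sum_words_eq r i1, wordPoly, map_list_sum, List.map_map]
  congr 1
  refine List.map_congr_left fun p _ => ?_
  rw [Function.comp_apply, map_list_sum, List.map_map, ← List.sum_map_mul_right]
  congr 1
  refine List.map_congr_left fun q _ => ?_
  rw [Function.comp_apply, map_list_sum, List.map_map, ← List.sum_map_mul_right,
    ← List.sum_map_mul_right]
  congr 1
  refine List.map_congr_left fun t _ => ?_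
  simp [map_falling]
  ring

theorem totalDegree_falling_X_le (v : Fin 3) (b : ℕ) :
    (falling (X v) b : MvPolynomial (Fin 3) ℤ).totalDegree ≤ b := by
  refine (totalDegree_finsetProd _ _).trans ?_
  refine (sum_le_card_nsmul _ _ 1 fun t _ => ?_).trans (by simp)
  refine (totalDegree_sub _ _).trans ?_
  rw [← map_natCast C t, totalDegree_C, totalDegree_X, max_eq_left zero_le_one]

theorem totalDegree_list_sum_le {L : List (MvPolynomial (Fin 3) ℤ)} {D : ℕ}
    (h : ∀ p ∈ L, p.totalDegree ≤ D) : L.sum.totalDegree ≤ D := by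
  induction L with
  | nil => simp
  | cons p L ih =>
    rw [List.sum_cons]
    exact (totalDegree_add _ _).trans (max_le (h p (by simp)) (ih fun q hq => h q (by simp [hq])))

theorem totalDegree_wordPoly_le {k D : ℕ} (H : (Fin k → ℕ) → (Fin k → ℕ) → (Fin k → ℕ) → ℤ)
    (h : ∀ a b c, H a b c ≠ 0 →
      (univ.image a).card + (univ.image b).card + (univ.image c).card ≤ D) :
    (wordPoly H).totalDegree ≤ D := by
  refine totalDegree_list_sum_le fun P hP => ?_
  obtain ⟨p, hp, rfl⟩ := List.mem_map.1 hP
  refine totalDegree_list_sum_le fun P hP => ?_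
  obtain ⟨q, hq, rfl⟩ := List.mem_map.1 hP
  refine totalDegree_list_sum_le fun P hP => ?_
  obtain ⟨t, ht, rfl⟩ := List.mem_map.1 hP
  by_cases hH : H p.1 q.1 t.1 = 0
  · simp [hH]
  have := h _ _ _ hH
  rw [image_of_mem_growthWords hp, image_of_mem_growthWords hq, image_of_mem_growthWords ht,
    card_range, card_range, card_range] at this
  refine (totalDegree_mul _ _).trans ?_
  have h0 : (H p.1 q.1 t.1 : MvPolynomial (Fin 3) ℤ).totalDegree = 0 := by
    rw [← map_intCast (C : ℤ →+* MvPolynomial (Fin 3) ℤ), totalDegree_C]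
  have h1 := totalDegree_mul (falling (X 0) p.2 * falling (X 1) q.2 : MvPolynomial (Fin 3) ℤ)
    (falling (X 2) t.2)
  have h2 := totalDegree_mul (falling (X 0) p.2 : MvPolynomial (Fin 3) ℤ) (falling (X 1) q.2)
  have := totalDegree_falling_X_le 0 p.2
  have := totalDegree_falling_X_le 1 q.2
  have := totalDegree_falling_X_le 2 t.2
  omega

/-- The polynomial that counts clash-free sequences of `k` triples. -/
def countPoly (k : ℕ) : MvPolynomial (Fin 3) ℤ :=
  wordPoly fun a b c : Fin k → ℕ => indep (clashRel a b c) univ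

/-- The polynomial that sums the cluster function over sequences of `k + 1` triples. -/
def clusterPoly (k : ℕ) : MvPolynomial (Fin 3) ℤ :=
  wordPoly fun a b c : Fin (k + 1) → ℕ => zeroCluster (clashRel a b c)

theorem eval_countPoly (k r s n : ℕ) :
    eval ![(r : ℤ), (s : ℤ), (n : ℤ)] (countPoly k) =
      indepSum (Clash (α := Fin r) (β := Fin s) (γ := Fin n)) (Fin k) := by
  rw [countPoly, eval_wordPoly]
  · simp only [clashRel_val, indepSum]
  · intro b c a a' h
    simp only [clashRel_congr h (fun _ _ => Iff.rfl) (fun _ _ => Iff.rfl)]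
  · intro a c b b' h
    simp only [clashRel_congr (fun _ _ => Iff.rfl) h (fun _ _ => Iff.rfl)]
  · intro a b c c' h
    simp only [clashRel_congr (fun _ _ => Iff.rfl) (fun _ _ => Iff.rfl) h]

theorem eval_clusterPoly (k r s n : ℕ) :
    eval ![(r : ℤ), (s : ℤ), (n : ℤ)] (clusterPoly k) =
      ∑ x, clusterSum (Clash (α := Fin r) (β := Fin s) (γ := Fin n)) (Fin k) x := by
  rw [clusterPoly, eval_wordPoly]
  · simp only [clashRel_val, clusterSum]
    rw [← Fintype.sum_prod_type']
    symm
    refine Fintype.sum_equiv (Fin.consEquiv fun _ => Fin r × Fin s × Fin n) _ _ fun e => ?_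
    simp [Fin.consEquiv, zeroCluster]
  · intro b c a a' h
    simp only [clashRel_congr h (fun _ _ => Iff.rfl) (fun _ _ => Iff.rfl)]
  · intro a c b b' h
    simp only [clashRel_congr (fun _ _ => Iff.rfl) h (fun _ _ => Iff.rfl)]
  · intro a b c c' h
    simp only [clashRel_congr (fun _ _ => Iff.rfl) (fun _ _ => Iff.rfl) h]

theorem totalDegree_clusterPoly_le (k : ℕ) : (clusterPoly k).totalDegree ≤ k + 3 :=
  totalDegree_wordPoly_le _ fun _ _ _ => card_images_le_of_zeroCluster_ne_zero

/-- The naturals are infinite in ℤ, so a polynomial is determined on their grid. This lifts counting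
identities to polynomial ones. -/
theorem eq_of_eval_natCast_eq {p q : MvPolynomial (Fin 3) ℤ}
    (h : ∀ r s n : ℕ, eval ![(r : ℤ), (s : ℤ), (n : ℤ)] p = eval ![(r : ℤ), (s : ℤ), (n : ℤ)] q) :
    p = q := by
  refine funext_set (fun _ => Set.range ((↑) : ℕ → ℤ))
    (fun _ => Set.infinite_range_of_injective Nat.cast_injective) fun x hx => ?_
  choose y hy using fun i => hx i (Set.mem_univ i)
  have : x = ![(y 0 : ℤ), (y 1 : ℤ), (y 2 : ℤ)] := by
    funext i
    fin_cases i <;> simp [hy]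
  rw [this]
  exact h _ _ _

theorem countPoly_succ (m : ℕ) :
    countPoly (m + 1) = ∑ k ∈ range (m + 1),
      (m.choose k : MvPolynomial (Fin 3) ℤ) * (clusterPoly k * countPoly (m - k)) := by
  refine eq_of_eval_natCast_eq fun r s n => ?_
  simp only [eval_countPoly, map_sum, map_mul, eval_clusterPoly, map_natCast]
  exact indepSum_succ _ (fun _ _ => Clash.symm) m

theorem countPoly_zero : countPoly 0 = 1 := by
  refine eq_of_eval_natCast_eq fun r s n => ?_
  simp [eval_countPoly, indepSum, indep]

end WordPoly

end

/-! ### Ordered partial Latin rectangles as clash-free sequences -/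

theorem mem_orderedPLR_iff {r s n m : ℕ} (e : Fin m → Fin r × Fin s × Fin n) :
    e ∈ orderedPLR r s n m ↔ ∀ i j, i ≠ j → ¬ Clash (e i) (e j) := by
  constructor
  · rintro ⟨L, ⟨⟨hrow, hcol⟩, -⟩, hL⟩
    have hcell : ∀ t, L (e t).1 (e t).2.1 = some (e t).2.2 := by
      intro t
      have hmem : (e t).2.2 ∈ multisetMatrix e (e t).1 (e t).2.1 :=
        Multiset.mem_map.2 ⟨t, by simp, rfl⟩
      rw [hL] at hmem
      cases h : L (e t).1 (e t).2.1 with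
      | none => simp [h, cellMultiset] at hmem
      | some k =>
        rw [h, cellMultiset, Multiset.mem_singleton] at hmem
        rw [hmem]
    -- A nonempty cell holds exactly one symbol, so only one index can point to it.
    have hinj : ∀ i j, (e i).1 = (e j).1 → (e i).2.1 = (e j).2.1 → i = j := by
      intro i j h1 h2
      have hcard := congrArg Multiset.card (hL (e i).1 (e i).2.1)
      rw [hcell i, cellMultiset, multisetMatrix, Multiset.card_map, Multiset.card_singleton,
        card_val, card_eq_one] at hcard
      obtain ⟨t, ht⟩ := hcard
      have hi : i ∈ ({t} : Finset (Fin m)) := by rw [← ht]; simp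
      have hj : j ∈ ({t} : Finset (Fin m)) := by rw [← ht]; simp [h1, h2]
      rw [mem_singleton.1 hi, mem_singleton.1 hj]
    rintro i j hij (⟨h1, h2⟩ | ⟨h1, h2⟩ | ⟨h1, h2⟩)
    · exact hij (hinj i j h1 h2)
    · refine hij (hinj i j h1 (hrow (e i).1 _ _ (e i).2.2 (hcell i) ?_))
      rw [h1, h2, hcell j]
    · refine hij (hinj i j (hcol (e i).2.1 _ _ (e i).2.2 (hcell i) ?_) h1)
      rw [h1, h2, hcell j]
  · intro h
    classical
    have hinj : ∀ i j, (e i).1 = (e j).1 → (e i).2.1 = (e j).2.1 → i = j := fun i j h1 h2 => by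
      by_contra hij
      exact h i j hij (Or.inl ⟨h1, h2⟩)
    -- By `hinj` the index filling a given cell is unique, so the choice is immaterial.
    let L : Matrix (Fin r) (Fin s) (Option (Fin n)) := fun i j =>
      if ht : ∃ t, (e t).1 = i ∧ (e t).2.1 = j then some (e ht.choose).2.2 else none
    have hcell : ∀ t, L (e t).1 (e t).2.1 = some (e t).2.2 := by
      intro t
      have ht : ∃ t', (e t').1 = (e t).1 ∧ (e t').2.1 = (e t).2.1 := ⟨t, rfl, rfl⟩
      simp only [L, dif_pos ht]
      rw [hinj _ _ ht.choose_spec.1 ht.choose_spec.2]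
    have hnone : ∀ i j, (¬ ∃ t, (e t).1 = i ∧ (e t).2.1 = j) → L i j = none :=
      fun i j ht => dif_neg ht
    have hsome : ∀ i j k, L i j = some k → ∃ t, e t = (i, j, k) := by
      intro i j k hk
      by_cases ht : ∃ t, (e t).1 = i ∧ (e t).2.1 = j
      · obtain ⟨t, rfl, rfl⟩ := ht
        rw [hcell, Option.some_inj] at hk
        exact ⟨t, by rw [← hk]⟩
      · rw [hnone i j ht] at hk
        cases hk
    refine ⟨L, ⟨⟨?_, ?_⟩, ?_⟩, ?_⟩
    · intro i j j' k hk hk'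
      obtain ⟨t, ht⟩ := hsome i j k hk
      obtain ⟨t', ht'⟩ := hsome i j' k hk'
      by_contra hne
      refine h t t' ?_ (by simp [Clash, ht, ht'])
      rintro rfl
      rw [ht] at ht'
      simp_all
    · intro j i i' k hk hk'
      obtain ⟨t, ht⟩ := hsome i j k hk
      obtain ⟨t', ht'⟩ := hsome i' j k hk'
      by_contra hne
      refine h t t' ?_ (by simp [Clash, ht, ht'])
      rintro rfl
      rw [ht] at ht'
      simp_all
    · have : (univ.filter fun c : Fin r × Fin s => L c.1 c.2 ≠ none) =
          univ.image fun t => ((e t).1, (e t).2.1) := by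
        ext c
        simp only [mem_filter, mem_univ, true_and, mem_image, Prod.ext_iff]
        constructor
        · intro hc
          by_contra ht
          exact hc (hnone _ _ ht)
        · rintro ⟨t, h1, h2⟩
          rw [← h1, ← h2, hcell]
          simp
      rw [plrWeight]
      convert congrArg card this
      rw [card_image_of_injective, card_univ, Fintype.card_fin]
      intro i j hij
      rw [Prod.mk.injEq] at hij
      exact hinj i j hij.1 hij.2
    · intro i j
      by_cases ht : ∃ t, (e t).1 = i ∧ (e t).2.1 = j
      · obtain ⟨t, rfl, rfl⟩ := ht
        have : (univ.filter fun t' => (e t').1 = (e t).1 ∧ (e t').2.1 = (e t).2.1) = {t} := by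
          ext t'
          simp only [mem_filter, mem_univ, true_and, mem_singleton]
          refine ⟨fun h' => hinj _ _ h'.1 h'.2, ?_⟩
          rintro rfl
          exact ⟨rfl, rfl⟩
        rw [hcell, multisetMatrix, this]
        rfl
      · rw [hnone i j ht, multisetMatrix, filter_false_of_mem fun t _ h' => ht ⟨t, h'⟩]
        rfl

theorem plrCount_eq_indepSum (m r s n : ℕ) :
    (plrCount m r s n : ℤ) =
      indepSum (Clash (α := Fin r) (β := Fin s) (γ := Fin n)) (Fin m) := by
  classical
  have h : orderedPLR r s n m = ↑(univ.filter fun e : Fin m → Fin r × Fin s × Fin n =>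
      ∀ i j, i ≠ j → ¬ Clash (e i) (e j)) := by
    ext e
    simp only [mem_orderedPLR_iff, coe_filter, mem_univ, true_and, Set.mem_ofPred_eq]
  rw [plrCount, h, Set.ncard_coe_finset, indepSum, card_filter, Nat.cast_sum]
  refine sum_congr rfl fun e _ => ?_
  simp [indep]

/-! ### Enumeration of clash-free triples of set partitions -/

section Lists

/-- The restricted growth words as lists. -/
def growthLists : (k : ℕ) → List (List ℕ × ℕ)
  | 0 => [([], 0)]
  | k + 1 => (growthLists k).flatMap fun p =>
      (List.range (p.2 + 1)).map fun x => (x :: p.1, max p.2 (x + 1))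

/-- The restricted growth words of length `k` with `i` distinct letters. -/
def growthClass (k i : ℕ) : List (List ℕ) := ((growthLists k).filter fun p => p.2 == i).map Prod.fst

/-- Whether `(x, y)` occurs among the pairs of entries of two lists in the same position. -/
def pairMem (x y : ℕ) : List ℕ → List ℕ → Bool
  | x' :: l, y' :: l' => (Nat.beq x x' && Nat.beq y y') || pairMem x y l l'
  | _, _ => false

/-- Whether the pairs of entries of two lists in the same position are distinct. -/
def pairNodup : List ℕ → List ℕ → Bool
  | x :: l, y :: l' => !(pairMem x y l l') && pairNodup l l'
  | _, _ => true

/-- The sum of the values of `f` on a list. -/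
def sumMap {α : Type*} (f : α → ℕ) : List α → ℕ
  | [] => 0
  | x :: l => Nat.add (f x) (sumMap f l)

/-- The number of clash-free triples of words from three lists. -/
def tripleCount (A B C : List (List ℕ)) : ℕ :=
  sumMap (fun p => sumMap (fun q => sumMap (fun t =>
    bif pairNodup p t && pairNodup q t then 1 else 0) (bif pairNodup p q then C else [])) B) A

theorem growthLists_eq (k : ℕ) :
    growthLists k = (growthWords k).map fun p => (List.ofFn p.1, p.2) := by
  induction k with
  | zero => simp [growthLists, growthWords]
  | succ k ih =>
    rw [growthLists, growthWords, ih, List.flatMap_map, List.map_flatMap]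
    simp [Function.comp_def]

theorem le_of_mem_growthLists {k : ℕ} {p : List ℕ × ℕ} (hp : p ∈ growthLists k) : p.2 ≤ k := by
  induction k generalizing p with
  | zero =>
    simp only [growthLists, List.mem_singleton] at hp
    simp [hp]
  | succ k ih =>
    simp only [growthLists, List.mem_flatMap, List.mem_map, List.mem_range] at hp
    obtain ⟨q, hq, x, hx, rfl⟩ := hp
    have := ih hq
    simp only
    omega

theorem pairMem_ofFn {k : ℕ} (x y : ℕ) (a b : Fin k → ℕ) :
    pairMem x y (List.ofFn a) (List.ofFn b) = true ↔ ∃ i, x = a i ∧ y = b i := by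
  induction k with
  | zero => simp [pairMem]
  | succ k ih =>
    rw [List.ofFn_succ, List.ofFn_succ, pairMem, Bool.or_eq_true, ih, Fin.exists_fin_succ]
    simp

theorem pairNodup_ofFn {k : ℕ} (a b : Fin k → ℕ) :
    pairNodup (List.ofFn a) (List.ofFn b) = true ↔
      ∀ i j, i ≠ j → ¬ (a i = a j ∧ b i = b j) := by
  induction k with
  | zero => simp [pairNodup]
  | succ k ih =>
    rw [List.ofFn_succ, List.ofFn_succ, pairNodup, Bool.and_eq_true, ih, Bool.not_eq_true',
      ← Bool.not_eq_true, pairMem_ofFn]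
    simp only [Fin.forall_fin_succ, ne_eq, not_true_eq_false, false_imp_iff, true_and,
      Fin.succ_inj, Fin.succ_ne_zero, not_false_eq_true, (Fin.succ_ne_zero _).symm, true_imp_iff,
      not_exists]
    constructor
    · rintro ⟨h1, h2⟩
      exact ⟨h1, fun i => ⟨fun h => h1 i ⟨h.1.symm, h.2.symm⟩, h2 i⟩⟩
    · rintro ⟨h1, h2⟩
      exact ⟨h1, fun i => (h2 i).2⟩

/-- Absence of clashes splits into three conditions, one for each pair of words. A failing first
pair can therefore be discarded before the third word is enumerated. -/
theorem indep_clashRel_univ {k : ℕ} (a b c : Fin k → ℕ) :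
    indep (clashRel a b c) univ =
      if pairNodup (List.ofFn a) (List.ofFn b) = true ∧
        (pairNodup (List.ofFn a) (List.ofFn c) = true ∧
          pairNodup (List.ofFn b) (List.ofFn c) = true) then 1 else 0 := by
  rw [indep]
  congr 1
  rw [eq_iff_iff, pairNodup_ofFn, pairNodup_ofFn, pairNodup_ofFn]
  simp only [mem_univ, true_imp_iff, clashRel, Clash, not_or]
  exact ⟨fun h => ⟨fun i j hij => (h i j hij).1, fun i j hij => (h i j hij).2.1,
    fun i j hij => (h i j hij).2.2⟩,
    fun h i j hij => ⟨h.1 i j hij, h.2.1 i j hij, h.2.2 i j hij⟩⟩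

variable {R : Type*} [CommRing R]

theorem cast_sumMap {α : Type*} (f : α → ℕ) (L : List α) :
    (sumMap f L : R) = (L.map fun x => (f x : R)).sum := by
  induction L with
  | nil => simp [sumMap]
  | cons x L ih =>
    rw [sumMap, List.map_cons, List.sum_cons, ← ih]
    exact Nat.cast_add _ _

theorem sum_map_finsetSum {α ι : Type*} (L : List α) (s : Finset ι) (f : α → ι → R) :
    (L.map fun x => ∑ i ∈ s, f x i).sum = ∑ i ∈ s, (L.map fun x => f x i).sum := by
  induction L with
  | nil => simp
  | cons x L ih => simp [ih, sum_add_distrib]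

theorem sum_growthWords (k : ℕ) (F : List ℕ → ℕ → R) :
    ((growthWords k).map fun p => F (List.ofFn p.1) p.2).sum =
      ∑ i ∈ range (k + 1), ((growthClass k i).map fun l => F l i).sum := by
  have h1 : ((growthWords k).map fun p => F (List.ofFn p.1) p.2) =
      (growthLists k).map fun p => F p.1 p.2 := by
    rw [growthLists_eq, List.map_map]
    rfl
  have h2 : ∀ L : List (List ℕ × ℕ), (∀ p ∈ L, p.2 ≤ k) → (L.map fun p => F p.1 p.2).sum =
      ∑ i ∈ range (k + 1), (((L.filter fun p => p.2 == i).map Prod.fst).map fun l => F l i).sum := by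
    intro L hL
    induction L with
    | nil => simp
    | cons p L ih =>
      have hp : p.2 ∈ range (k + 1) := mem_range.2 (Nat.lt_succ_of_le (hL p (by simp)))
      rw [List.map_cons, List.sum_cons, ih fun q hq => hL q (by simp [hq]),
        ← add_sum_erase _ _ hp, ← add_sum_erase _ _ hp, ← add_assoc]
      congr 1
      · simp
      · refine sum_congr rfl fun i hi => ?_
        rw [List.filter_cons_of_neg]
        simpa using (ne_of_mem_erase hi).symm
  rw [h1, h2 _ fun p => le_of_mem_growthLists]
  rfl

theorem cast_tripleCount (A B C : List (List ℕ)) :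
    (tripleCount A B C : R) = (A.map fun p => (B.map fun q => (C.map fun t =>
      (((if pairNodup p q = true ∧ (pairNodup p t = true ∧ pairNodup q t = true) then 1 else 0 :
        ℤ)) : R)).sum).sum).sum := by
  simp only [tripleCount, cast_sumMap]
  congr 1
  refine List.map_congr_left fun p _ => ?_
  congr 1
  refine List.map_congr_left fun q _ => ?_
  cases pairNodup p q
  · simp
  · simp only [cond_true, true_and]
    congr 1
    refine List.map_congr_left fun t _ => ?_
    cases pairNodup p t <;> cases pairNodup q t <;> simp

theorem sum_growthWords_triple (k : ℕ) (J : List ℕ → List ℕ → List ℕ → R) (g : ℕ → ℕ → ℕ → R) :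
    ((growthWords k).map fun p => ((growthWords k).map fun q => ((growthWords k).map fun t =>
      J (List.ofFn p.1) (List.ofFn q.1) (List.ofFn t.1) * g p.2 q.2 t.2).sum).sum).sum =
    ∑ i ∈ range (k + 1), ∑ j ∈ range (k + 1), ∑ l ∈ range (k + 1),
      ((growthClass k i).map fun p => ((growthClass k j).map fun q =>
        ((growthClass k l).map fun t => J p q t).sum).sum).sum * g i j l := by
  have e1 : ∀ (p q : List ℕ) (i j : ℕ),
      ((growthWords k).map fun t => J p q (List.ofFn t.1) * g i j t.2).sum =
        ∑ l ∈ range (k + 1), ((growthClass k l).map fun t => J p q t).sum * g i j l := by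
    intro p q i j
    rw [sum_growthWords k fun t l => J p q t * g i j l]
    simp_rw [List.sum_map_mul_right]
  have e2 : ∀ (p : List ℕ) (i : ℕ),
      ((growthWords k).map fun q => ∑ l ∈ range (k + 1),
        ((growthClass k l).map fun t => J p (List.ofFn q.1) t).sum * g i q.2 l).sum =
        ∑ j ∈ range (k + 1), ∑ l ∈ range (k + 1), ((growthClass k j).map fun q =>
          ((growthClass k l).map fun t => J p q t).sum).sum * g i j l := by
    intro p i
    rw [sum_growthWords k fun q j => ∑ l ∈ range (k + 1),
        ((growthClass k l).map fun t => J p q t).sum * g i j l]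
    simp_rw [sum_map_finsetSum, List.sum_map_mul_right]
  simp_rw [e1, e2]
  rw [sum_growthWords k fun p i => ∑ j ∈ range (k + 1), ∑ l ∈ range (k + 1),
    ((growthClass k j).map fun q => ((growthClass k l).map fun t => J p q t).sum).sum * g i j l]
  simp_rw [sum_map_finsetSum, List.sum_map_mul_right]

end Lists

-- The falling factorials depend only on the numbers of letters, so the words are grouped by these
-- and only integer counts remain to be computed.
open MvPolynomial in
theorem countPoly_eq_sum (k : ℕ) :
    countPoly k = ∑ i ∈ range (k + 1), ∑ j ∈ range (k + 1), ∑ l ∈ range (k + 1),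
      (tripleCount (growthClass k i) (growthClass k j) (growthClass k l) :
        MvPolynomial (Fin 3) ℤ) *
        (falling (X 0) i * falling (X 1) j * falling (X 2) l) := by
  simp only [countPoly, wordPoly, indep_clashRel_univ, cast_tripleCount]
  exact sum_growthWords_triple k (fun p q t => ((if pairNodup p q = true ∧
    (pairNodup p t = true ∧ pairNodup q t = true) then 1 else 0 : ℤ) : MvPolynomial (Fin 3) ℤ))
    fun i j l => falling (X 0) i * falling (X 1) j * falling (X 2) l

/-- The numbers of clash-free triples of words of length `k`, by their numbers of letters. -/
def countTable : ℕ → List (List (List ℕ))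
  | 1 => [[[0, 0], [0, 0]],
      [[0, 0], [0, 1]]]
  | 2 => [[[0, 0, 0], [0, 0, 0], [0, 0, 0]],
      [[0, 0, 0], [0, 0, 0], [0, 0, 1]],
      [[0, 0, 0], [0, 0, 1], [0, 1, 1]]]
  | 3 => [[[0, 0, 0, 0], [0, 0, 0, 0], [0, 0, 0, 0], [0, 0, 0, 0]],
      [[0, 0, 0, 0], [0, 0, 0, 0], [0, 0, 0, 0], [0, 0, 0, 1]],
      [[0, 0, 0, 0], [0, 0, 0, 0], [0, 0, 6, 6], [0, 0, 6, 3]],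
      [[0, 0, 0, 0], [0, 0, 0, 1], [0, 0, 6, 3], [0, 1, 3, 1]]]
  | 4 => [[[0, 0, 0, 0, 0], [0, 0, 0, 0, 0], [0, 0, 0, 0, 0], [0, 0, 0, 0, 0], [0, 0, 0, 0, 0]],
      [[0, 0, 0, 0, 0], [0, 0, 0, 0, 0], [0, 0, 0, 0, 0], [0, 0, 0, 0, 0], [0, 0, 0, 0, 1]],
      [[0, 0, 0, 0, 0], [0, 0, 0, 0, 0], [0, 0, 6, 12, 6], [0, 0, 12, 60, 24], [0, 0, 6, 24, 7]],
      [[0, 0, 0, 0, 0], [0, 0, 0, 0, 0], [0, 0, 12, 60, 24], [0, 0, 60, 120, 30], [0, 0, 24, 30, 6]],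
      [[0, 0, 0, 0, 0], [0, 0, 0, 0, 1], [0, 0, 6, 24, 7], [0, 0, 24, 30, 6], [0, 1, 7, 6, 1]]]
  | 5 => [[[0, 0, 0, 0, 0, 0], [0, 0, 0, 0, 0, 0], [0, 0, 0, 0, 0, 0], [0, 0, 0, 0, 0, 0], [0, 0, 0, 0, 0, 0], [0, 0, 0, 0, 0, 0]],
      [[0, 0, 0, 0, 0, 0], [0, 0, 0, 0, 0, 0], [0, 0, 0, 0, 0, 0], [0, 0, 0, 0, 0, 0], [0, 0, 0, 0, 0, 0], [0, 0, 0, 0, 0, 1]],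
      [[0, 0, 0, 0, 0, 0], [0, 0, 0, 0, 0, 0], [0, 0, 0, 0, 0, 0], [0, 0, 0, 180, 240, 60], [0, 0, 0, 240, 360, 80], [0, 0, 0, 60, 80, 15]],
      [[0, 0, 0, 0, 0, 0], [0, 0, 0, 0, 0, 0], [0, 0, 0, 180, 240, 60], [0, 0, 180, 1590, 1620, 300], [0, 0, 240, 1620, 1260, 190], [0, 0, 60, 300, 190, 25]],
      [[0, 0, 0, 0, 0, 0], [0, 0, 0, 0, 0, 0], [0, 0, 0, 240, 360, 80], [0, 0, 240, 1620, 1260, 190], [0, 0, 360, 1260, 720, 90], [0, 0, 80, 190, 90, 10]],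
      [[0, 0, 0, 0, 0, 0], [0, 0, 0, 0, 0, 1], [0, 0, 0, 60, 80, 15], [0, 0, 60, 300, 190, 25], [0, 0, 80, 190, 90, 10], [0, 1, 15, 25, 10, 1]]]
  | _ => []

-- A finite check by kernel evaluation; for `k = 5` it runs over triples of the 52 set partitions.
set_option maxRecDepth 100000 in
theorem tripleCount_growthClass : ∀ k < 6, 1 ≤ k → ∀ i < k + 1, ∀ j < k + 1, ∀ l < k + 1,
    tripleCount (growthClass k i) (growthClass k j) (growthClass k l) =
      (((countTable k).getD i []).getD j []).getD l 0 := by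
  decide +kernel

open MvPolynomial in
theorem countPoly_eq_table (k : ℕ) (h1 : 1 ≤ k) (h5 : k ≤ 5) :
    countPoly k = ∑ i ∈ range (k + 1), ∑ j ∈ range (k + 1), ∑ l ∈ range (k + 1),
      (((((countTable k).getD i []).getD j []).getD l 0 : ℕ) : MvPolynomial (Fin 3) ℤ) *
        (falling (X 0) i * falling (X 1) j * falling (X 2) l) := by
  rw [countPoly_eq_sum]
  refine sum_congr rfl fun i hi => sum_congr rfl fun j hj => sum_congr rfl fun l hl => ?_
  rw [tripleCount_growthClass k (by omega) h1 i (mem_range.1 hi) j (mem_range.1 hj) l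
    (mem_range.1 hl)]

/-! ### Explicit monomial symmetric polynomials -/

section Mono

open MvPolynomial

theorem image_perm_comp (a b c : ℕ) :
    univ.image (fun σ : Equiv.Perm (Fin 3) => (![a, b, c] : Fin 3 → ℕ) ∘ σ) =
      {![a, b, c], ![a, c, b], ![b, a, c], ![b, c, a], ![c, a, b], ![c, b, a]} := by
  have h : (univ : Finset (Equiv.Perm (Fin 3))) =
      {1, Equiv.swap 1 2, Equiv.swap 0 1, Equiv.swap 0 1 * Equiv.swap 1 2,
        Equiv.swap 1 2 * Equiv.swap 0 1, Equiv.swap 0 2} := by decide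
  rw [h]
  simp only [image_insert, image_singleton]
  congr! <;> (funext i; fin_cases i <;> rfl)

theorem mono3_of_ne (a b c : ℕ) (hab : a ≠ b) (hac : a ≠ c) (hbc : b ≠ c) :
    mono3 a b c = X 0 ^ a * X 1 ^ b * X 2 ^ c + X 0 ^ a * X 1 ^ c * X 2 ^ b +
      X 0 ^ b * X 1 ^ a * X 2 ^ c + X 0 ^ b * X 1 ^ c * X 2 ^ a +
      X 0 ^ c * X 1 ^ a * X 2 ^ b + X 0 ^ c * X 1 ^ b * X 2 ^ a := by
  rw [mono3, image_perm_comp]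
  repeat rw [sum_insert (by simp [hab, hac, hbc, hab.symm, hac.symm, hbc.symm])]
  simp only [sum_singleton, Fin.prod_univ_three]
  simp [add_assoc]

theorem mono3_left_ne (a b : ℕ) (hab : a ≠ b) :
    mono3 a b b = X 0 ^ a * X 1 ^ b * X 2 ^ b + X 0 ^ b * X 1 ^ a * X 2 ^ b +
      X 0 ^ b * X 1 ^ b * X 2 ^ a := by
  have h : ({![a, b, b], ![a, b, b], ![b, a, b], ![b, b, a], ![b, a, b], ![b, b, a]} :
      Finset (Fin 3 → ℕ)) = {![a, b, b], ![b, a, b], ![b, b, a]} := by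
    ext x
    simp only [mem_insert, mem_singleton]
    tauto
  rw [mono3, image_perm_comp, h]
  repeat rw [sum_insert (by simp [hab, hab.symm])]
  simp only [sum_singleton, Fin.prod_univ_three]
  simp [add_assoc]

theorem mono3_right_ne (a b : ℕ) (hab : a ≠ b) :
    mono3 a a b = X 0 ^ a * X 1 ^ a * X 2 ^ b + X 0 ^ a * X 1 ^ b * X 2 ^ a +
      X 0 ^ b * X 1 ^ a * X 2 ^ a := by
  have h : ({![a, a, b], ![a, b, a], ![a, a, b], ![a, b, a], ![b, a, a], ![b, a, a]} :
      Finset (Fin 3 → ℕ)) = {![a, a, b], ![a, b, a], ![b, a, a]} := by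
    ext x
    simp only [mem_insert, mem_singleton]
    tauto
  rw [mono3, image_perm_comp, h]
  repeat rw [sum_insert (by simp [hab, hab.symm])]
  simp only [sum_singleton, Fin.prod_univ_three]
  simp [add_assoc]

theorem mono3_self (a : ℕ) : mono3 a a a = X 0 ^ a * X 1 ^ a * X 2 ^ a := by
  rw [mono3, image_perm_comp]
  simp [Fin.prod_univ_three]

end Mono

/-! ### The exact formula for m at most 5 -/

open MvPolynomial

theorem leadingPoly_eq (m : ℕ) :
    leadingPoly m = rsn ^ m +
      ((m.choose 2 : MvPolynomial (Fin 3) ℤ) * rsn ^ (m + 1 - 2) * leadingCoeffPoly 2 +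
      (m.choose 3 : MvPolynomial (Fin 3) ℤ) * rsn ^ (m + 1 - 3) * leadingCoeffPoly 3 +
      (m.choose 4 : MvPolynomial (Fin 3) ℤ) * rsn ^ (m + 1 - 4) * leadingCoeffPoly 4 +
      (m.choose 5 : MvPolynomial (Fin 3) ℤ) * rsn ^ (m + 1 - 5) * leadingCoeffPoly 5 +
      (m.choose 6 : MvPolynomial (Fin 3) ℤ) * rsn ^ (m + 1 - 6) * leadingCoeffPoly 6 +
      (m.choose 7 : MvPolynomial (Fin 3) ℤ) * rsn ^ (m + 1 - 7) * leadingCoeffPoly 7 +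
      (m.choose 8 : MvPolynomial (Fin 3) ℤ) * rsn ^ (m + 1 - 8) * leadingCoeffPoly 8) := by
  rw [leadingPoly, show Icc 2 8 = ({2, 3, 4, 5, 6, 7, 8} : Finset ℕ) from rfl]
  repeat rw [sum_insert (by decide)]
  rw [sum_singleton]
  ring

theorem countPoly_one : countPoly 1 = leadingPoly 1 := by
  rw [countPoly_eq_table 1 (by decide) (by decide), leadingPoly_eq]
  simp [sum_range_succ, countTable, falling, rsn, Nat.choose]

theorem countPoly_two : countPoly 2 = leadingPoly 2 := by
  rw [countPoly_eq_table 2 (by decide) (by decide), leadingPoly_eq]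
  simp (disch := decide) only [leadingCoeffPoly, mono3_self, mono3_left_ne, mono3_right_ne,
    mono3_of_ne, rsn]
  simp [sum_range_succ, countTable, falling, prod_range_succ, Nat.choose]
  ring

theorem countPoly_three : countPoly 3 = leadingPoly 3 := by
  rw [countPoly_eq_table 3 (by decide) (by decide), leadingPoly_eq]
  simp (disch := decide) only [leadingCoeffPoly, mono3_self, mono3_left_ne, mono3_right_ne,
    mono3_of_ne, rsn]
  simp [sum_range_succ, countTable, falling, prod_range_succ, Nat.choose]
  ring

theorem countPoly_four : countPoly 4 = leadingPoly 4 := by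
  rw [countPoly_eq_table 4 (by decide) (by decide), leadingPoly_eq]
  simp (disch := decide) only [leadingCoeffPoly, mono3_self, mono3_left_ne, mono3_right_ne,
    mono3_of_ne, rsn]
  simp [sum_range_succ, countTable, falling, prod_range_succ, Nat.choose]
  ring

set_option maxHeartbeats 2000000 in
theorem countPoly_five : countPoly 5 = leadingPoly 5 := by
  rw [countPoly_eq_table 5 (by decide) (by decide), leadingPoly_eq]
  simp (disch := decide) only [leadingCoeffPoly, mono3_self, mono3_left_ne, mono3_right_ne,
    mono3_of_ne, rsn]
  simp [sum_range_succ, countTable, falling, prod_range_succ, Nat.choose]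
  ring

noncomputable section

/-! ### Splitting off isolated triples -/

section Core

variable {R : Type*} [CommRing R]

/-- The part of the count of sequences of length `v` that comes from clash graphs without isolated
vertices, in terms of the cluster sums `c`. -/
def coreSeq (c : ℕ → R) : ℕ → R
  | 0 => 1
  | v + 1 => ∑ k : Fin v, (v.choose (k + 1) : R) * (c (k + 1) * coreSeq c (v - (k + 1)))
termination_by v => v
decreasing_by omega

theorem coreSeq_zero (c : ℕ → R) : coreSeq c 0 = 1 := by rw [coreSeq]

theorem coreSeq_succ (c : ℕ → R) (v : ℕ) :
    coreSeq c (v + 1) =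
      ∑ k ∈ range v, (v.choose (k + 1) : R) * (c (k + 1) * coreSeq c (v - (k + 1))) := by
  rw [coreSeq, Fin.sum_univ_eq_sum_range
    fun k => (v.choose (k + 1) : R) * (c (k + 1) * coreSeq c (v - (k + 1)))]

/-- Both sides choose `v` of `m` points and then `k + 1` of those, or first the `k + 1` and then the
remaining `u = v - (k + 1)`. -/
theorem sum_choose_mul_coreSeq_succ (c : ℕ → R) (N : R) (m : ℕ) :
    ∑ v ∈ range (m + 1), (m.choose v : R) * N ^ (m - v) * coreSeq c (v + 1) =
      ∑ k ∈ range m, (m.choose (k + 1) : R) * (c (k + 1) *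
        ∑ u ∈ range (m - (k + 1) + 1),
          ((m - (k + 1)).choose u : R) * N ^ (m - (k + 1) - u) * coreSeq c u) := by
  simp_rw [coreSeq_succ, mul_sum]
  rw [sum_sigma', sum_sigma']
  refine sum_nbij' (fun p => ⟨p.2, p.1 - (p.2 + 1)⟩) (fun p => ⟨p.2 + (p.1 + 1), p.1⟩)
    ?_ ?_ ?_ ?_ ?_
  · rintro ⟨v, k⟩ h
    simp only [mem_sigma, mem_range] at h ⊢
    omega
  · rintro ⟨k, u⟩ h
    simp only [mem_sigma, mem_range] at h ⊢
    omega
  · rintro ⟨v, k⟩ h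
    simp only [mem_sigma, mem_range] at h
    simp only [Sigma.mk.injEq, heq_eq_eq, and_true]
    omega
  · rintro ⟨k, u⟩ h
    simp
  · rintro ⟨v, k⟩ h
    simp only [mem_sigma, mem_range] at h
    have h1 := Nat.choose_mul (n := m) (k := v) (s := k + 1) (by omega)
    have h2 : (m.choose v : R) * (v.choose (k + 1) : R) =
        (m.choose (k + 1) : R) * ((m - (k + 1)).choose (v - (k + 1)) : R) := by
      exact_mod_cast congrArg (Nat.cast : ℕ → R) h1
    have h3 : m - (k + 1) - (v - (k + 1)) = m - v := by omega
    simp only [h3]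
    linear_combination N ^ (m - v) * c (k + 1) * coreSeq c (v - (k + 1)) * h2

/-- In exponential generating functions, F' = cF and G' = (c - c_0)G with value 1 at 0 give F =
exp(c_0 x) G. In coefficients this is Pascal's rule with the preceding exchange of summation. -/
theorem eq_sum_coreSeq (c f : ℕ → R) (h0 : f 0 = 1)
    (hf : ∀ m, f (m + 1) = ∑ k ∈ range (m + 1), (m.choose k : R) * (c k * f (m - k))) (m : ℕ) :
    f m = ∑ v ∈ range (m + 1), (m.choose v : R) * c 0 ^ (m - v) * coreSeq c v := by
  induction m using Nat.strong_induction_on with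
  | _ m ih =>
    cases m with
    | zero => simp [h0, coreSeq_zero]
    | succ m =>
      have h1 : ∑ k ∈ range m, (m.choose (k + 1) : R) * (c (k + 1) * f (m - (k + 1))) =
          ∑ v ∈ range (m + 1), (m.choose v : R) * c 0 ^ (m - v) * coreSeq c (v + 1) := by
        rw [sum_choose_mul_coreSeq_succ]
        refine sum_congr rfl fun k hk => ?_
        rw [ih (m - (k + 1)) (by omega)]
      have h2 : c 0 * f m = c 0 ^ (m + 1) * coreSeq c 0 +
          ∑ v ∈ range (m + 1), (m.choose (v + 1) : R) * c 0 ^ (m - v) * coreSeq c (v + 1) := by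
        rw [ih m (by omega), sum_range_succ', sum_range_succ _ m, mul_add, mul_sum,
          Nat.choose_succ_self]
        simp only [Nat.choose_zero_right, Nat.cast_one, one_mul, Nat.sub_zero, Nat.cast_zero,
          zero_mul, add_zero, pow_succ']
        rw [add_comm, mul_assoc]
        congr 1
        refine sum_congr rfl fun v hv => ?_
        rw [mem_range] at hv
        rw [show m - v = m - (v + 1) + 1 by omega, pow_succ']
        ring
      have h3 : ∑ v ∈ range (m + 1), ((m + 1).choose (v + 1) : R) * c 0 ^ (m + 1 - (v + 1)) *
            coreSeq c (v + 1) =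
          ∑ v ∈ range (m + 1), (m.choose v : R) * c 0 ^ (m - v) * coreSeq c (v + 1) +
          ∑ v ∈ range (m + 1), (m.choose (v + 1) : R) * c 0 ^ (m - v) * coreSeq c (v + 1) := by
        rw [← sum_add_distrib]
        refine sum_congr rfl fun v _ => ?_
        rw [Nat.choose_succ_succ, Nat.add_sub_add_right, Nat.cast_add]
        ring
      rw [hf, sum_range_succ', h1, sum_range_succ' _ (m + 1), h3]
      simp only [Nat.choose_zero_right, Nat.cast_one, one_mul, Nat.sub_zero, h2]
      ring

/-- The coefficients in this and the following formulas count set partitions into blocks of size at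
least 2, by block sizes; `c k` stands for a block of size `k + 1`. -/
theorem coreSeq_one (c : ℕ → R) : coreSeq c 1 = 0 := by simp [coreSeq_succ]

theorem coreSeq_two (c : ℕ → R) : coreSeq c 2 = c 1 := by simp [coreSeq_succ, coreSeq_zero]

theorem coreSeq_three (c : ℕ → R) : coreSeq c 3 = c 2 := by
  simp [coreSeq_succ c 2, sum_range_succ, coreSeq_zero, coreSeq_one]

theorem coreSeq_four (c : ℕ → R) : coreSeq c 4 = c 3 + 3 * c 1 ^ 2 := by
  simp [coreSeq_succ c 3, sum_range_succ, coreSeq_zero, coreSeq_one, coreSeq_two, Nat.choose]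
  ring

theorem coreSeq_five (c : ℕ → R) : coreSeq c 5 = c 4 + 10 * c 1 * c 2 := by
  simp [coreSeq_succ c 4, sum_range_succ, coreSeq_zero, coreSeq_one, coreSeq_two, coreSeq_three,
    Nat.choose]
  ring

theorem coreSeq_six (c : ℕ → R) :
    coreSeq c 6 = c 5 + (15 * c 3 * c 1 + 10 * c 2 ^ 2 + 15 * c 1 ^ 3) := by
  simp [coreSeq_succ c 5, sum_range_succ, coreSeq_zero, coreSeq_one, coreSeq_two, coreSeq_three,
    coreSeq_four, Nat.choose]
  ring

/-- Coefficients written as casts from `ℕ` mark the products that go to the remainder, in the form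
used by `totalDegree_natCast_mul_le`; the product with a bare numeral supplies the leading
polynomial. -/
theorem coreSeq_seven (c : ℕ → R) :
    coreSeq c 7 = c 6 + (21 : ℕ) * (c 4 * c 1) + (35 : ℕ) * (c 3 * c 2) +
      105 * c 2 * c 1 ^ 2 := by
  simp [coreSeq_succ c 6, sum_range_succ, coreSeq_zero, coreSeq_one, coreSeq_two, coreSeq_three,
    coreSeq_four, coreSeq_five, Nat.choose]
  ring

theorem coreSeq_eight (c : ℕ → R) :
    coreSeq c 8 = c 7 + (28 : ℕ) * (c 5 * c 1) + (56 : ℕ) * (c 4 * c 2) + (35 : ℕ) * (c 3 * c 3) +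
      (210 : ℕ) * (c 3 * (c 1 * c 1)) + (280 : ℕ) * (c 2 * (c 2 * c 1)) + 105 * c 1 ^ 4 := by
  simp [coreSeq_succ c 7, sum_range_succ, coreSeq_zero, coreSeq_one, coreSeq_two, coreSeq_three,
    coreSeq_four, coreSeq_five, coreSeq_six, Nat.choose]
  ring

end Core

/-! ### Degree bounds -/

section Degree

open MvPolynomial

theorem totalDegree_add_le_of_le {p q : MvPolynomial (Fin 3) ℤ} {D : ℕ} (hp : p.totalDegree ≤ D)
    (hq : q.totalDegree ≤ D) : (p + q).totalDegree ≤ D :=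
  (totalDegree_add _ _).trans (max_le hp hq)

theorem totalDegree_mul_le_of_le {p q : MvPolynomial (Fin 3) ℤ} {a b D : ℕ}
    (hp : p.totalDegree ≤ a) (hq : q.totalDegree ≤ b) (hD : a + b ≤ D) :
    (p * q).totalDegree ≤ D :=
  (totalDegree_mul _ _).trans ((add_le_add hp hq).trans hD)

theorem totalDegree_natCast_mul_le (n : ℕ) {p : MvPolynomial (Fin 3) ℤ} {D : ℕ}
    (hp : p.totalDegree ≤ D) : ((n : MvPolynomial (Fin 3) ℤ) * p).totalDegree ≤ D := by
  refine totalDegree_mul_le_of_le (a := 0) ?_ hp (by omega)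
  rw [← map_natCast (C : ℤ →+* MvPolynomial (Fin 3) ℤ), totalDegree_C]

theorem totalDegree_rsn_pow_le (k : ℕ) : (rsn ^ k).totalDegree ≤ 3 * k := by
  have h : rsn.totalDegree ≤ 3 :=
    totalDegree_mul_le_of_le (totalDegree_mul_le_of_le (totalDegree_X (R := ℤ) (0 : Fin 3)).le
      (totalDegree_X (R := ℤ) (1 : Fin 3)).le le_rfl) (totalDegree_X (R := ℤ) (2 : Fin 3)).le le_rfl
  refine (totalDegree_pow _ _).trans ?_
  rw [mul_comm]
  gcongr

/-- A block of size `j` has degree at most `j + 2`, and there are at most `v / 2` blocks. -/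
theorem totalDegree_coreSeq_le {c : ℕ → MvPolynomial (Fin 3) ℤ}
    (hc : ∀ k, (c k).totalDegree ≤ k + 3) (v : ℕ) :
    (coreSeq c v).totalDegree ≤ v + 2 * (v / 2) := by
  induction v using Nat.strong_induction_on with
  | _ v ih =>
    cases v with
    | zero => simp [coreSeq_zero]
    | succ v =>
      rw [coreSeq_succ]
      refine totalDegree_finsetSum_le fun k hk => ?_
      rw [mem_range] at hk
      exact totalDegree_natCast_mul_le _ (totalDegree_mul_le_of_le (hc _)
        (ih (v - (k + 1)) (by omega)) (by omega))

end Degree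

/-! ### Matching the leading terms and bounding the remainder -/

open MvPolynomial

theorem clusterPoly_zero : clusterPoly 0 = rsn := by
  have h := countPoly_succ 0
  simp only [zero_add, range_one, sum_singleton, Nat.choose_self, Nat.cast_one, one_mul,
    Nat.sub_self, countPoly_zero, mul_one] at h
  rw [← h, countPoly_one, leadingPoly_eq]
  simp [Nat.choose]

theorem countPoly_eq_sum_coreSeq (m : ℕ) :
    countPoly m = ∑ v ∈ range (m + 1),
      (m.choose v : MvPolynomial (Fin 3) ℤ) * rsn ^ (m - v) * coreSeq clusterPoly v := by
  rw [← clusterPoly_zero]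
  exact eq_sum_coreSeq clusterPoly countPoly countPoly_zero countPoly_succ m

theorem leadingCoeffPoly_eq_zero {v : ℕ} (h : v ∉ Icc 2 8) : leadingCoeffPoly v = 0 := by
  rw [mem_Icc] at h
  unfold leadingCoeffPoly
  split <;> first | rfl | omega

/-- The part of `coreSeq clusterPoly v` that is not accounted for by `leadingPoly`. -/
def coreRemainder (v : ℕ) : MvPolynomial (Fin 3) ℤ :=
  coreSeq clusterPoly v - rsn * leadingCoeffPoly v - if v = 0 then 1 else 0

theorem countPoly_sub_leadingPoly (m : ℕ) :
    countPoly m - leadingPoly m = ∑ v ∈ range (m + 1),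
      (m.choose v : MvPolynomial (Fin 3) ℤ) * (rsn ^ (m - v) * coreRemainder v) := by
  have h1 : ∑ v ∈ Icc 2 8, (m.choose v : MvPolynomial (Fin 3) ℤ) * rsn ^ (m + 1 - v) *
      leadingCoeffPoly v = ∑ v ∈ range (m + 1), (m.choose v : MvPolynomial (Fin 3) ℤ) *
        rsn ^ (m + 1 - v) * leadingCoeffPoly v := by
    have h2 : ∀ v, v ∉ range (m + 1) → (m.choose v : MvPolynomial (Fin 3) ℤ) *
        rsn ^ (m + 1 - v) * leadingCoeffPoly v = 0 := fun v hv => by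
      rw [Nat.choose_eq_zero_of_lt (by simpa using hv)]
      simp
    rw [← sum_subset (inter_subset_left (s₂ := range (m + 1))) fun v hv hv' => h2 v fun h =>
      hv' (mem_inter.2 ⟨hv, h⟩)]
    refine sum_subset inter_subset_right fun v hv hv' => ?_
    rw [leadingCoeffPoly_eq_zero fun h => hv' (mem_inter.2 ⟨h, hv⟩), mul_zero]
  have h3 : rsn ^ m = ∑ v ∈ range (m + 1), (m.choose v : MvPolynomial (Fin 3) ℤ) *
      -- The pure power is the `v = 0` term, as `coreSeq` starts with 1.
      rsn ^ (m - v) * if v = 0 then 1 else 0 := by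
    simp
  rw [countPoly_eq_sum_coreSeq, leadingPoly, h1, h3, ← sum_add_distrib, ← sum_sub_distrib]
  refine sum_congr rfl fun v hv => ?_
  rw [coreRemainder, show m + 1 - v = m - v + 1 by rw [mem_range] at hv; omega, pow_succ]
  ring

theorem countPoly_eq_leadingPoly {k : ℕ} (h1 : 1 ≤ k) (h5 : k ≤ 5) :
    countPoly k = leadingPoly k := by
  interval_cases k
  · exact countPoly_one
  · exact countPoly_two
  · exact countPoly_three
  · exact countPoly_four
  · exact countPoly_five

/-- The system is triangular: for `m = v` the expansion of the difference, which is zero, contains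
`coreRemainder v` with coefficient 1, and all earlier remainders vanish. -/
theorem coreRemainder_eq_zero {v : ℕ} (hv : v ≤ 5) : coreRemainder v = 0 := by
  induction v using Nat.strong_induction_on with
  | _ v ih =>
    rcases Nat.eq_zero_or_pos v with rfl | hpos
    · simp [coreRemainder, coreSeq_zero, leadingCoeffPoly]
    · have h := countPoly_sub_leadingPoly v
      rw [countPoly_eq_leadingPoly hpos hv, sub_self, sum_range_succ, sum_eq_zero] at h
      · simpa using h.symm
      · intro u hu
        rw [mem_range] at hu
        rw [ih u hu (by omega), mul_zero, mul_zero]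

theorem coreSeq_clusterPoly_eq {v : ℕ} (h1 : 1 ≤ v) (h5 : v ≤ 5) :
    coreSeq clusterPoly v = rsn * leadingCoeffPoly v := by
  have h := coreRemainder_eq_zero h5
  rw [coreRemainder, if_neg (by omega), sub_zero, sub_eq_zero] at h
  exact h

theorem clusterPoly_one : clusterPoly 1 = rsn * leadingCoeffPoly 2 := by
  rw [← coreSeq_clusterPoly_eq (by norm_num) (by norm_num), coreSeq_two]

theorem clusterPoly_two : clusterPoly 2 = rsn * leadingCoeffPoly 3 := by
  rw [← coreSeq_clusterPoly_eq (by norm_num) (by norm_num), coreSeq_three]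

theorem clusterPoly_three :
    clusterPoly 3 = rsn * leadingCoeffPoly 4 - 3 * (rsn * leadingCoeffPoly 2) ^ 2 := by
  rw [← coreSeq_clusterPoly_eq (by norm_num) (by norm_num), coreSeq_four, clusterPoly_one]
  ring

/-- These are the products in `coreSeq_six` whose degree bound exceeds 8. The term `7900 * rsn ^ 2`,
of degree 6, is what `leadingCoeffPoly 6` leaves out; the next two identities are analogous. -/
theorem leadingCoeffPoly_six_spec :
    15 * clusterPoly 3 * clusterPoly 1 + 10 * clusterPoly 2 ^ 2 + 15 * clusterPoly 1 ^ 3 =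
      rsn * leadingCoeffPoly 6 + (7900 : ℕ) * rsn ^ 2 := by
  rw [clusterPoly_one, clusterPoly_two, clusterPoly_three]
  simp (disch := decide) only [leadingCoeffPoly, mono3_self, mono3_left_ne, mono3_right_ne,
    mono3_of_ne, rsn]
  push_cast
  ring

theorem leadingCoeffPoly_seven_spec :
    105 * clusterPoly 2 * clusterPoly 1 ^ 2 =
      rsn * leadingCoeffPoly 7 + (5880 : ℕ) * rsn ^ 3 := by
  rw [clusterPoly_one, clusterPoly_two]
  simp (disch := decide) only [leadingCoeffPoly, mono3_self, mono3_left_ne, mono3_right_ne,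
    mono3_of_ne, rsn]
  push_cast
  ring

theorem leadingCoeffPoly_eight_spec :
    105 * clusterPoly 1 ^ 4 = rsn * leadingCoeffPoly 8 + (1680 : ℕ) * rsn ^ 4 := by
  rw [clusterPoly_one]
  simp (disch := decide) only [leadingCoeffPoly, mono3_self, mono3_left_ne, mono3_right_ne,
    mono3_of_ne, rsn]
  push_cast
  ring

theorem coreRemainder_six :
    coreRemainder 6 = clusterPoly 5 + (7900 : ℕ) * rsn ^ 2 := by
  rw [coreRemainder, coreSeq_six, leadingCoeffPoly_six_spec, if_neg (by norm_num)]
  ring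

theorem coreRemainder_seven :
    coreRemainder 7 = clusterPoly 6 + (21 : ℕ) * (clusterPoly 4 * clusterPoly 1) +
      (35 : ℕ) * (clusterPoly 3 * clusterPoly 2) + (5880 : ℕ) * rsn ^ 3 := by
  rw [coreRemainder, coreSeq_seven, leadingCoeffPoly_seven_spec, if_neg (by norm_num)]
  ring

theorem coreRemainder_eight :
    coreRemainder 8 = clusterPoly 7 + (28 : ℕ) * (clusterPoly 5 * clusterPoly 1) +
      (56 : ℕ) * (clusterPoly 4 * clusterPoly 2) + (35 : ℕ) * (clusterPoly 3 * clusterPoly 3) +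
      (210 : ℕ) * (clusterPoly 3 * (clusterPoly 1 * clusterPoly 1)) +
      (280 : ℕ) * (clusterPoly 2 * (clusterPoly 2 * clusterPoly 1)) + (1680 : ℕ) * rsn ^ 4 := by
  rw [coreRemainder, coreSeq_eight, leadingCoeffPoly_eight_spec, if_neg (by norm_num)]
  ring

theorem totalDegree_coreRemainder_le {v : ℕ} (hv : 6 ≤ v) :
    (coreRemainder v).totalDegree ≤ 3 * v - 10 := by
  have hc := totalDegree_clusterPoly_le
  have hmul : ∀ {i j D : ℕ}, i + 3 + (j + 3) ≤ D →
      (clusterPoly i * clusterPoly j).totalDegree ≤ D :=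
    fun h => totalDegree_mul_le_of_le (hc _) (hc _) h
  have hN : ∀ {k D : ℕ}, 3 * k ≤ D → (rsn ^ k).totalDegree ≤ D :=
    fun h => (totalDegree_rsn_pow_le _).trans h
  rcases (by omega : v = 6 ∨ v = 7 ∨ v = 8 ∨ 9 ≤ v) with rfl | rfl | rfl | h9
  · rw [coreRemainder_six]
    exact totalDegree_add_le_of_le ((hc 5).trans (by norm_num))
      (totalDegree_natCast_mul_le _ (hN (by norm_num)))
  · rw [coreRemainder_seven]
    refine totalDegree_add_le_of_le (totalDegree_add_le_of_le (totalDegree_add_le_of_le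
      ((hc 6).trans (by norm_num)) ?_) ?_) ?_ <;> refine totalDegree_natCast_mul_le _ ?_
    · exact hmul (by norm_num)
    · exact hmul (by norm_num)
    · exact hN (by norm_num)
  · rw [coreRemainder_eight]
    refine totalDegree_add_le_of_le (totalDegree_add_le_of_le (totalDegree_add_le_of_le
      (totalDegree_add_le_of_le (totalDegree_add_le_of_le (totalDegree_add_le_of_le
      ((hc 7).trans (by norm_num)) ?_) ?_) ?_) ?_) ?_) ?_ <;>
      refine totalDegree_natCast_mul_le _ ?_
    · exact hmul (by norm_num)
    · exact hmul (by norm_num)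
    · exact hmul (by norm_num)
    · exact totalDegree_mul_le_of_le (hc _) (hmul le_rfl) (by norm_num)
    · exact totalDegree_mul_le_of_le (hc _) (hmul le_rfl) (by norm_num)
    · exact hN (by norm_num)
  · rw [coreRemainder, leadingCoeffPoly_eq_zero (by simp; omega), if_neg (by omega), mul_zero,
      sub_zero, sub_zero]
    -- The bound is tight at `v = 9`: 9 + 8 = 17 = 27 - 10.
    exact (totalDegree_coreSeq_le hc v).trans (by omega)

theorem totalDegree_countPoly_sub_leadingPoly_le (m : ℕ) :
    (countPoly m - leadingPoly m).totalDegree ≤ 3 * m - 10 := by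
  rw [countPoly_sub_leadingPoly]
  refine totalDegree_finsetSum_le fun v hv => ?_
  rw [mem_range] at hv
  refine totalDegree_natCast_mul_le _ ?_
  -- Only terms with `v ≥ 6` survive, which forces `m ≥ 6`, so the truncated subtraction does no
  -- harm.
  rcases Nat.lt_or_ge 5 v with h | h
  · exact totalDegree_mul_le_of_le (totalDegree_rsn_pow_le _) (totalDegree_coreRemainder_le h)
      (by omega)
  · simp [coreRemainder_eq_zero h]

end

end PLRCount

open MvPolynomial PLRCount in
theorem mainTheorem2 (m : ℕ) (hm : 1 ≤ m) :
    ∃ R : MvPolynomial (Fin 3) ℤ,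
      (∀ d ∈ R.support, ((Finsupp.degree d : ℕ) : ℤ) ≤ 3 * (m : ℤ) - 10) ∧
      (m ≤ 5 → R = 0) ∧
      ∀ r s n : ℕ, 1 ≤ r → 1 ≤ s → 1 ≤ n →
        (plrCount m r s n : ℤ) =
          MvPolynomial.eval ![(r : ℤ), (s : ℤ), (n : ℤ)] (leadingPoly m + R) := by
  have hzero : m ≤ 5 → countPoly m - leadingPoly m = 0 := fun h => by
    rw [countPoly_eq_leadingPoly hm h, sub_self]
  refine ⟨countPoly m - leadingPoly m, fun d hd => ?_, hzero, fun r s n _ _ _ => ?_⟩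
  -- The integer bound is negative for `m ≤ 3`; it holds there because the remainder is zero and has
  -- empty support.
  · rcases Nat.lt_or_ge 5 m with h | h
    · have h1 : Finsupp.degree d ≤ 3 * m - 10 :=
        (le_totalDegree hd).trans (totalDegree_countPoly_sub_leadingPoly_le m)
      omega
    · rw [hzero h] at hd
      simp at hd
  · rw [add_sub_cancel, eval_countPoly, plrCount_eq_indepSum]
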